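/- Let $a,b,m,n$ be positive integers with $am-bn\in\{1,-1\}$, let $g$ be holomorphic near $0\in\mathbb{C}$, and let $f$ be meromorphic near $0\in\mathbb{C}$ such that $(x,y)\mapsto x^ay^bf(x^ny^m)$ extends to a holomorphic function near $(0,0)\in\mathbb{C}^2$ vanishing at $(0,0)$. Let $X,Y$ be holomorphic vector fields on an open neighborhood $V$ of $(0,0)\in\mathbb{C}^2$ which, in some holomorphic coordinates $(x,y)$ centered at $(0,0)$, are given near $(0,0)$ by $$X=x^ay^b\Big[mx\frac{\partial}{\partial x}-ny\frac{\partial}{\partial y}\Big],$$ $$Y=g(x^ny^m)\Big[x\big(-bm+x^ay^bf(x^ny^m)\big)\frac{\partial}{\partial x}+y\Big(am-\frac nm\,x^ay^bf(x^ny^m)\Big)\frac{\partial}{\partial y}\Big]$$ (such $X$ and $Y$ commute near $(0,0)$). Assume that either $g(0)\neq0$, or $g(0)=g''(0)=f_0=0$ and $g'(0)\neq0$, where $f_0$ is the constant term of the Laurent series of $f$ at $0$. Then there are a connected, non-compact, Hausdorff, second countable complex manifold $M$ of complex dimension $2$, complete holomorphic vector fields $\overline X,\overline Y$ on $M$ which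 generate a holomorphic action of $\mathbb{C}^2$ on $M$, an open neighborhood $U\subseteq V$ of $(0,0)$, and a biholomorphism $\psi$ from $U$ onto an open subset of $M$ whose differential takes $X$ to $\overline X$ and $Y$ to $\overline Y$. (A holomorphic vector field is complete if all its integral curves are defined for all complex times.) -/

import Mathlib

open Topology Filter
open scoped Manifold ContDiff

/-- `c : ℤ → ℂ` is the family of Laurent coefficients at `0` of the function `f`, which has at most
a pole there: `f z = ∑ c k * z ^ k` on a punctured disc around `0`, with only finitely many
negative powers. In particular `c 0` is the constant term. -/
def IsLaurentSeriesAtZero (f : ℂ → ℂ) (c : ℤ → ℂ) : Prop :=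
  (∃ N : ℕ, ∀ k : ℤ, k < -(N : ℤ) → c k = 0) ∧
    ∀ᶠ z in 𝓝[≠] (0 : ℂ), HasSum (fun k : ℤ => c k * z ^ k) (f z)

/-- `F` is the holomorphic extension, near the origin, of `(x, y) ↦ x ^ a * y ^ b * f (x ^ n * y ^ m)`
(which is a priori only defined off the coordinate axes), and it has order at least `1` at the
origin. -/
def IsHolomorphicExtension (a b m n : ℕ) (f : ℂ → ℂ) (F : ℂ × ℂ → ℂ) : Prop :=
  AnalyticAt ℂ F 0 ∧ F 0 = 0 ∧
    ∀ᶠ p in 𝓝 (0 : ℂ × ℂ), p.1 ≠ 0 → p.2 ≠ 0 →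
      F p = p.1 ^ a * p.2 ^ b * f (p.1 ^ n * p.2 ^ m)

/-- The vector field `x ^ a * y ^ b * (m x ∂/∂x - n y ∂/∂y)` on `ℂ²`. -/
def normalFormX (a b m n : ℕ) (p : ℂ × ℂ) : ℂ × ℂ :=
  (p.1 ^ a * p.2 ^ b) • ((m : ℂ) * p.1, -((n : ℂ) * p.2))

/-- The vector field
`g (x ^ n * y ^ m) * (x * (-b m + F) ∂/∂x + y * (a m - (n / m) F) ∂/∂y)`, where `F (x, y)` stands for
(the holomorphic extension of) `x ^ a * y ^ b * f (x ^ n * y ^ m)`. -/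
noncomputable def normalFormY (a b m n : ℕ) (g : ℂ → ℂ) (F : ℂ × ℂ → ℂ) (p : ℂ × ℂ) : ℂ × ℂ :=
  g (p.1 ^ n * p.2 ^ m) •
    (p.1 * (-((b : ℂ) * m) + F p), p.2 * ((a : ℂ) * m - (n : ℂ) / m * F p))

/-- The germs at the origin of the vector fields `X`, `Y` are given by the normal form above in
some common holomorphic coordinates `φ = (x, y)` centred at the origin. -/
def HasNormalForm (a b m n : ℕ) (f g : ℂ → ℂ) (X Y : ℂ × ℂ → ℂ × ℂ) : Prop :=
  ∃ (φ : ℂ × ℂ → ℂ × ℂ) (F : ℂ × ℂ → ℂ),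
    AnalyticAt ℂ φ 0 ∧ φ 0 = 0 ∧ (fderiv ℂ φ 0).IsInvertible ∧
    IsHolomorphicExtension a b m n f F ∧
    ∀ᶠ p in 𝓝 (0 : ℂ × ℂ),
      fderiv ℂ φ p (X p) = normalFormX a b m n (φ p) ∧
      fderiv ℂ φ p (Y p) = normalFormY a b m n g F (φ p)

section Surface

variable {M : Type} [TopologicalSpace M] [ChartedSpace (ℂ × ℂ) M]

/-- A holomorphic vector field on a complex surface, as a section of the tangent bundle. -/
def IsHolomorphicVectorField [IsManifold 𝓘(ℂ, ℂ × ℂ) ω M]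
    (Z : (p : M) → TangentSpace 𝓘(ℂ, ℂ × ℂ) p) : Prop :=
  ContMDiff 𝓘(ℂ, ℂ × ℂ) (𝓘(ℂ, ℂ × ℂ).prod 𝓘(ℂ, ℂ × ℂ)) ω
    (fun p => (⟨p, Z p⟩ : TangentBundle 𝓘(ℂ, ℂ × ℂ) M))

/-- `Z` is complete (over `ℂ`): through every point there passes an integral curve defined for
every complex time. -/
def IsCompleteVectorField (Z : (p : M) → TangentSpace 𝓘(ℂ, ℂ × ℂ) p) : Prop :=
  ∀ p : M, ∃ γ : ℂ → M, γ 0 = p ∧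
    ∀ t : ℂ, HasMFDerivAt 𝓘(ℂ, ℂ) 𝓘(ℂ, ℂ × ℂ) γ t
      ((ContinuousLinearMap.id ℂ ℂ).smulRight (Z (γ t)) : ℂ →L[ℂ] ℂ × ℂ)

/-- `Φ` is a holomorphic action of the additive Lie group `ℂ²` on `M` whose infinitesimal generators
are `X` (first factor) and `Y` (second factor). -/
structure IsHolomorphicActionGeneratedBy (Φ : ℂ × ℂ → M → M)
    (X Y : (p : M) → TangentSpace 𝓘(ℂ, ℂ × ℂ) p) : Prop where
  holomorphic : ContMDiff (𝓘(ℂ, ℂ × ℂ).prod 𝓘(ℂ, ℂ × ℂ)) 𝓘(ℂ, ℂ × ℂ) ω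
    (fun q : (ℂ × ℂ) × M => Φ q.1 q.2)
  zero : ∀ p, Φ 0 p = p
  add : ∀ v w p, Φ (v + w) p = Φ v (Φ w p)
  generator : ∀ p, HasMFDerivAt 𝓘(ℂ, ℂ × ℂ) 𝓘(ℂ, ℂ × ℂ) (fun v : ℂ × ℂ => Φ v p) 0
    ((ContinuousLinearMap.fst ℂ ℂ ℂ).smulRight (X p : ℂ × ℂ) +
      (ContinuousLinearMap.snd ℂ ℂ ℂ).smulRight (Y p : ℂ × ℂ) : ℂ × ℂ →L[ℂ] ℂ × ℂ)

/-- `ψ` is a biholomorphism from the open set `U` of `ℂ²` onto an open set of `M`. -/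
def IsBiholomorphismOnto (ψ : OpenPartialHomeomorph (ℂ × ℂ) M) (U : Set (ℂ × ℂ)) : Prop :=
  ψ.source = U ∧ ContMDiffOn 𝓘(ℂ, ℂ × ℂ) 𝓘(ℂ, ℂ × ℂ) ω ψ ψ.source ∧
    ContMDiffOn 𝓘(ℂ, ℂ × ℂ) 𝓘(ℂ, ℂ × ℂ) ω ψ.symm ψ.target

/-- The differential of `ψ` takes the vector field `X` on `U` to the restriction of `Z`. -/
def PushesForwardTo (ψ : OpenPartialHomeomorph (ℂ × ℂ) M) (U : Set (ℂ × ℂ))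
    (X : ℂ × ℂ → ℂ × ℂ) (Z : (p : M) → TangentSpace 𝓘(ℂ, ℂ × ℂ) p) : Prop :=
  ∀ p ∈ U, mfderiv 𝓘(ℂ, ℂ × ℂ) 𝓘(ℂ, ℂ × ℂ) ψ p (X p) = Z (ψ p)

end Surface

/-! Put `u = x^n y^m`, `w = x^a y^b` and `ε = am - bn = ±1`. Since `ε` is a unit, `(u, w)` are
global coordinates on the torus `xy ≠ 0`, where `X u = 0`, `X w = ε w²`, `Y u = ε m g(u) u` and `Y w
= (ε/m) g(u) F w`. In terms of `U = 1/u`, `W = 1/w` this reads `X = -ε ∂_W` and `Y = -ε m g(u) U ∂_U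
- (ε/m) g(u) f(u) ∂_W`.

Suppose that `g(z) = l + κ z` and `F = c₀ w` with `lκ = κc₀ = 0`. Then both fields are affine in
`(U, W)`, hence complete on the whole `(U, W)`-plane; on the axes of the `(x, y)`-plane, `X`
vanishes and `Y` is linear, so they are complete there too. Gluing the two planes along the torus
gives the surface, on which the flows form a holomorphic action of `ℂ²` (`toricAction_add`,
`contMDiff_toricAction`).

The general case reduces to this one by a local change of coordinates (`exists_straightening`).
Replacing `u` by `u exp(σ(u))` brings `z g(z) d/dz` to `(l z + κ z²) d/dz`; this is linearization if
`g(0) ≠ 0`, and otherwise it is possible because `g''(0) = 0` makes the residue of `1/(z g)` vanish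
(`exists_linearizing_exponent`). Replacing `1/w` by `1/w + ε h(u)` keeps the form of `X` and removes
from `f` all but its constant term, up to a unit `r`: `h` solves `u h' = (ε/m²)(f - c₀ r)`, whose
right side has no constant term, so no logarithm appears. The product `w h(u)` is holomorphic
because holomorphy of `F` bounds the pole of `f` (`IsHolomorphicExtension.exists_polarMonomials`).
-/

/-! ### Topology of the gluing of two copies of a space. -/

/-- Two copies of `E` glued along an open partial homeomorphism `e`. As a set, it is the disjoint
union of the first copy and of the part of the second copy outside of the target of `e`. -/
def Glued {E : Type} [TopologicalSpace E] (e : OpenPartialHomeomorph E E) : Type :=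
  E ⊕ {q : E // q ∉ e.target}

namespace Glued

section Topology

variable {E : Type} [TopologicalSpace E] (e : OpenPartialHomeomorph E E)

/-- The inclusion of the first copy. -/
def inl (p : E) : Glued e := Sum.inl p

open Classical in
/-- The inclusion of the second copy. -/
noncomputable def inr (q : E) : Glued e :=
  if h : q ∈ e.target then Sum.inl (e.symm q) else Sum.inr ⟨q, h⟩

variable {e}

theorem inr_of_mem {q : E} (h : q ∈ e.target) : inr e q = inl e (e.symm q) := by
  exact dif_pos h

theorem inr_of_notMem {q : E} (h : q ∉ e.target) : inr e q = Sum.inr ⟨q, h⟩ := dif_neg h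

theorem inr_apply {p : E} (h : p ∈ e.source) : inr e (e p) = inl e p := by
  rw [inr_of_mem (e.map_source h), e.left_inv h]

theorem inl_injective : Function.Injective (inl e) := Sum.inl_injective

theorem inl_eq_inr {p q : E} : inl e p = inr e q ↔ p ∈ e.source ∧ e p = q := by
  constructor
  · intro h
    by_cases hq : q ∈ e.target
    · rw [inr_of_mem hq] at h
      have := inl_injective h
      subst this
      exact ⟨e.map_target hq, e.right_inv hq⟩
    · simp [inr, inl, hq] at h
  · rintro ⟨h, rfl⟩
    rw [inr_apply h]

theorem inr_injective : Function.Injective (inr e) := by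
  intro q q' h
  by_cases hq : q ∈ e.target
  · rw [inr_of_mem hq, inl_eq_inr, e.right_inv hq] at h
    exact h.2
  · by_cases hq' : q' ∈ e.target
    · rw [inr_of_mem hq', eq_comm, inl_eq_inr, e.right_inv hq'] at h
      exact h.2.symm
    · rw [inr_of_notMem hq, inr_of_notMem hq'] at h
      exact congrArg Subtype.val (Sum.inr_injective h)

theorem cases (z : Glued e) : (∃ p, z = inl e p) ∨ ∃ q, z = inr e q := by
  rcases z with p | q
  · exact Or.inl ⟨p, rfl⟩
  · exact Or.inr ⟨q.1, (inr_of_notMem q.2).symm⟩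

noncomputable instance : TopologicalSpace (Glued e) :=
  TopologicalSpace.coinduced (inl e) inferInstance ⊔ TopologicalSpace.coinduced (inr e) inferInstance

theorem isOpen_iff {s : Set (Glued e)} :
    IsOpen s ↔ IsOpen (inl e ⁻¹' s) ∧ IsOpen (inr e ⁻¹' s) := Iff.rfl

theorem continuous_inl : Continuous (inl e) := ⟨fun _ hs => (isOpen_iff.1 hs).1⟩

theorem continuous_inr : Continuous (inr e) := ⟨fun _ hs => (isOpen_iff.1 hs).2⟩

theorem isOpenEmbedding_inl : IsOpenEmbedding (inl e) := by
  refine .of_continuous_injective_isOpenMap continuous_inl inl_injective fun s hs => ?_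
  rw [isOpen_iff, Set.preimage_image_eq _ inl_injective]
  refine ⟨hs, ?_⟩
  convert! e.symm.isOpen_inter_preimage hs using 1
  ext q
  simp only [Set.mem_preimage, Set.mem_image, inl_eq_inr, Set.mem_inter_iff]
  constructor
  · rintro ⟨p, hp, hps, rfl⟩
    exact ⟨e.map_source hps, by rwa [e.left_inv hps]⟩
  · rintro ⟨hq, hqs⟩
    exact ⟨_, hqs, e.map_target hq, e.right_inv hq⟩

theorem isOpenEmbedding_inr : IsOpenEmbedding (inr e) := by
  refine .of_continuous_injective_isOpenMap continuous_inr inr_injective fun s hs => ?_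
  rw [isOpen_iff, Set.preimage_image_eq _ inr_injective]
  refine ⟨?_, hs⟩
  convert! e.isOpen_inter_preimage hs using 1
  ext p
  simp only [Set.mem_preimage, Set.mem_image, eq_comm (a := inr e _), inl_eq_inr,
    Set.mem_inter_iff]
  constructor
  · rintro ⟨q, hq, hps, rfl⟩
    exact ⟨hps, hq⟩
  · rintro ⟨hp, hps⟩
    exact ⟨_, hps, hp, rfl⟩

theorem range_union : Set.range (inl e) ∪ Set.range (inr e) = Set.univ := by
  ext z
  rcases cases z with ⟨p, rfl⟩ | ⟨q, rfl⟩ <;> simp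

theorem connectedSpace [ConnectedSpace E] (h : e.source.Nonempty) : ConnectedSpace (Glued e) := by
  rw [connectedSpace_iff_univ, ← range_union]
  obtain ⟨p, hp⟩ := h
  exact (isConnected_range continuous_inl).union ⟨inl e p, ⟨p, rfl⟩, ⟨e p, inr_apply hp⟩⟩
    (isConnected_range continuous_inr)

theorem secondCountableTopology [SecondCountableTopology E] :
    SecondCountableTopology (Glued e) := by
  have h1 := isOpenEmbedding_inl (e := e)
  have h2 := isOpenEmbedding_inr (e := e)
  have : ∀ i : Bool, SecondCountableTopology
      (cond i (Set.range (inl e)) (Set.range (inr e)) : Set (Glued e)) := by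
    rintro (_ | _)
    · exact h2.isEmbedding.toHomeomorph.symm.secondCountableTopology
    · exact h1.isEmbedding.toHomeomorph.symm.secondCountableTopology
  refine TopologicalSpace.secondCountableTopology_of_countable_cover
    (U := fun i : Bool => cond i (Set.range (inl e)) (Set.range (inr e))) ?_ ?_
  · rintro (_ | _)
    · exact h2.isOpen_range
    · exact h1.isOpen_range
  · rw [← range_union]
    ext z
    simp [or_comm]

/-- A gluing is Hausdorff if points not in the gluing domains are separated. -/
theorem t2Space [T2Space E]
    (h : ∀ p q, p ∉ e.source → q ∉ e.target → ∃ s t : Set E, IsOpen s ∧ IsOpen t ∧ p ∈ s ∧ q ∈ t ∧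
      ∀ p' ∈ s, p' ∈ e.source → e p' ∉ t) : T2Space (Glued e) := by
  have key : ∀ p q, inl e p ≠ inr e q → ∃ u v : Set (Glued e), IsOpen u ∧ IsOpen v ∧
      inl e p ∈ u ∧ inr e q ∈ v ∧ Disjoint u v := by
    intro p q hne
    -- If either point lies in a glued region, both lie in one copy, which is Hausdorff and open.
    by_cases hp : p ∈ e.source
    · rw [← inr_apply hp] at hne ⊢
      obtain ⟨u, v, hu, hv, h1, h2, h3⟩ := t2_separation (inr_injective.ne_iff.1 hne)
      exact ⟨inr e '' u, inr e '' v, isOpenEmbedding_inr.isOpenMap _ hu,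
        isOpenEmbedding_inr.isOpenMap _ hv, ⟨_, h1, rfl⟩, ⟨_, h2, rfl⟩,
        (Set.disjoint_image_iff inr_injective).2 h3⟩
    by_cases hq : q ∈ e.target
    · rw [inr_of_mem hq] at hne ⊢
      obtain ⟨u, v, hu, hv, h1, h2, h3⟩ := t2_separation (inl_injective.ne_iff.1 hne)
      exact ⟨inl e '' u, inl e '' v, isOpenEmbedding_inl.isOpenMap _ hu,
        isOpenEmbedding_inl.isOpenMap _ hv, ⟨_, h1, rfl⟩, ⟨_, h2, rfl⟩,
        (Set.disjoint_image_iff inl_injective).2 h3⟩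
    obtain ⟨s, t, hs, ht, h1, h2, h3⟩ := h p q hp hq
    refine ⟨inl e '' s, inr e '' t, isOpenEmbedding_inl.isOpenMap _ hs,
      isOpenEmbedding_inr.isOpenMap _ ht, ⟨_, h1, rfl⟩, ⟨_, h2, rfl⟩, ?_⟩
    rw [Set.disjoint_left]
    rintro _ ⟨p', hp', rfl⟩ ⟨q', hq', hpq⟩
    obtain ⟨h4, rfl⟩ := inl_eq_inr.1 hpq.symm
    exact h3 p' hp' h4 hq'
  refine ⟨fun z z' hne => ?_⟩
  rcases cases z with ⟨p, rfl⟩ | ⟨q, rfl⟩ <;> rcases cases z' with ⟨p', rfl⟩ | ⟨q', rfl⟩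
  · obtain ⟨u, v, hu, hv, h1, h2, h3⟩ := t2_separation (inl_injective.ne_iff.1 hne)
    exact ⟨inl e '' u, inl e '' v, isOpenEmbedding_inl.isOpenMap _ hu,
      isOpenEmbedding_inl.isOpenMap _ hv, ⟨_, h1, rfl⟩, ⟨_, h2, rfl⟩,
      (Set.disjoint_image_iff inl_injective).2 h3⟩
  · exact key p q' hne
  · obtain ⟨u, v, hu, hv, h1, h2, h3⟩ := key p' q hne.symm
    exact ⟨v, u, hv, hu, h2, h1, h3.symm⟩
  · obtain ⟨u, v, hu, hv, h1, h2, h3⟩ := t2_separation (inr_injective.ne_iff.1 hne)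
    exact ⟨inr e '' u, inr e '' v, isOpenEmbedding_inr.isOpenMap _ hu,
      isOpenEmbedding_inr.isOpenMap _ hv, ⟨_, h1, rfl⟩, ⟨_, h2, rfl⟩,
      (Set.disjoint_image_iff inr_injective).2 h3⟩

/-- The unglued part of the first copy is the complement of the open second copy, so it is closed
and would inherit compactness. -/
theorem noncompactSpace (h : ¬ IsCompact e.sourceᶜ) : NoncompactSpace (Glued e) := by
  refine ⟨fun hc => h ?_⟩
  have hcl : IsClosed (Set.range (inr e))ᶜ := isOpenEmbedding_inr.isOpen_range.isClosed_compl
  have := hc.inter_right hcl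
  rw [Set.univ_inter] at this
  rw [isOpenEmbedding_inl.isEmbedding.isCompact_iff]
  convert! this using 1
  ext z
  simp only [Set.mem_image, Set.mem_compl_iff, Set.mem_range]
  constructor
  · rintro ⟨p, hp, rfl⟩ ⟨q, hq⟩
    exact hp (inl_eq_inr.1 hq.symm).1
  · intro hz
    rcases cases z with ⟨p, rfl⟩ | ⟨q, rfl⟩
    · exact ⟨p, fun hp => hz ⟨e p, inr_apply hp⟩, rfl⟩
    · exact absurd ⟨q, rfl⟩ hz

variable [Nonempty E] (e)

/-- The inverse of the chart of `Glued e` given by the first copy. -/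
noncomputable def inlHomeomorph : OpenPartialHomeomorph E (Glued e) :=
  isOpenEmbedding_inl.toOpenPartialHomeomorph (inl e)

/-- The inverse of the chart of `Glued e` given by the second copy. -/
noncomputable def inrHomeomorph : OpenPartialHomeomorph E (Glued e) :=
  isOpenEmbedding_inr.toOpenPartialHomeomorph (inr e)

@[simp] theorem inlHomeomorph_coe : ⇑(inlHomeomorph e) = inl e := rfl
@[simp] theorem inrHomeomorph_coe : ⇑(inrHomeomorph e) = inr e := rfl
@[simp] theorem inlHomeomorph_source : (inlHomeomorph e).source = Set.univ := rfl
@[simp] theorem inrHomeomorph_source : (inrHomeomorph e).source = Set.univ := rfl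
@[simp] theorem inlHomeomorph_target : (inlHomeomorph e).target = Set.range (inl e) := by
  simp [inlHomeomorph]
@[simp] theorem inrHomeomorph_target : (inrHomeomorph e).target = Set.range (inr e) := by
  simp [inrHomeomorph]

@[simp] theorem inlHomeomorph_symm_inl (p : E) : (inlHomeomorph e).symm (inl e p) = p :=
  (inlHomeomorph e).left_inv (x := p) trivial

@[simp] theorem inrHomeomorph_symm_inr (q : E) : (inrHomeomorph e).symm (inr e q) = q :=
  (inrHomeomorph e).left_inv (x := q) trivial

open Classical in
noncomputable instance : ChartedSpace E (Glued e) where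
  atlas := {(inlHomeomorph e).symm, (inrHomeomorph e).symm}
  chartAt z := if z ∈ Set.range (inl e) then (inlHomeomorph e).symm else (inrHomeomorph e).symm
  mem_chart_source z := by
    split_ifs with h
    · simpa using h
    · have := range_union (e := e) ▸ Set.mem_univ z
      simpa using this.resolve_left h
  chart_mem_atlas z := by
    split_ifs <;> simp

end Topology

/-! ### Complex structure on the gluing. -/

section Manifold

variable {E : Type} [NormedAddCommGroup E] [NormedSpace ℂ E] {e : OpenPartialHomeomorph E E}

/-- The only transition maps are the identity, `e` and its inverse. -/
theorem isManifold {k : ℕ∞ω} (h1 : ContDiffOn ℂ k e e.source)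
    (h2 : ContDiffOn ℂ k e.symm e.target) : IsManifold 𝓘(ℂ, E) k (Glued e) := by
  refine isManifold_of_contDiffOn _ _ _ fun c c' hc hc' => ?_
  simp only [modelWithCornersSelf_coe, modelWithCornersSelf_coe_symm, Function.id_comp,
    Function.comp_id, Set.preimage_id, Set.range_id, Set.inter_univ]
  rcases hc with rfl | rfl <;> rcases hc' with rfl | rfl
  · exact contDiffOn_id.congr fun p _ => by simp
  · have hs : ((inlHomeomorph e).symm.symm ≫ₕ (inrHomeomorph e).symm).source ⊆ e.source := by
      intro p hp
      simp only [OpenPartialHomeomorph.symm_symm, OpenPartialHomeomorph.trans_source,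
        OpenPartialHomeomorph.symm_source, inlHomeomorph_source, inrHomeomorph_target,
        Set.univ_inter, Set.mem_preimage, inlHomeomorph_coe, Set.mem_range] at hp
      obtain ⟨q, hq⟩ := hp
      exact (inl_eq_inr.1 hq.symm).1
    refine (h1.mono hs).congr fun p hp => ?_
    simp [← inr_apply (hs hp)]
  · have hs : ((inrHomeomorph e).symm.symm ≫ₕ (inlHomeomorph e).symm).source ⊆ e.target := by
      intro p hp
      simp only [OpenPartialHomeomorph.symm_symm, OpenPartialHomeomorph.trans_source,
        OpenPartialHomeomorph.symm_source, inrHomeomorph_source, inlHomeomorph_target,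
        Set.univ_inter, Set.mem_preimage, inrHomeomorph_coe, Set.mem_range] at hp
      obtain ⟨q, hq⟩ := hp
      obtain ⟨h, h'⟩ := inl_eq_inr.1 hq
      rw [← h']
      exact e.map_source h
    refine (h2.mono hs).congr fun p hp => ?_
    simp [inr_of_mem (hs hp)]
  · exact contDiffOn_id.congr fun p _ => by simp

variable {k : ℕ∞ω} [IsManifold 𝓘(ℂ, E) k (Glued e)]

theorem contMDiff_inl : ContMDiff 𝓘(ℂ, E) 𝓘(ℂ, E) k (inl e) := by
  have h : (inlHomeomorph e).symm ∈ IsManifold.maximalAtlas 𝓘(ℂ, E) k (Glued e) :=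
    IsManifold.subset_maximalAtlas (Or.inl rfl)
  exact contMDiffOn_univ.1 (contMDiffOn_symm_of_mem_maximalAtlas h)

theorem contMDiff_inr : ContMDiff 𝓘(ℂ, E) 𝓘(ℂ, E) k (inr e) := by
  have h : (inrHomeomorph e).symm ∈ IsManifold.maximalAtlas 𝓘(ℂ, E) k (Glued e) :=
    IsManifold.subset_maximalAtlas (Or.inr rfl)
  exact contMDiffOn_univ.1 (contMDiffOn_symm_of_mem_maximalAtlas h)

theorem contMDiffOn_inlHomeomorph_symm :
    ContMDiffOn 𝓘(ℂ, E) 𝓘(ℂ, E) k (inlHomeomorph e).symm (Set.range (inl e)) := by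
  have h : (inlHomeomorph e).symm ∈ IsManifold.maximalAtlas 𝓘(ℂ, E) k (Glued e) :=
    IsManifold.subset_maximalAtlas (Or.inl rfl)
  simpa using contMDiffOn_of_mem_maximalAtlas h

theorem contMDiffOn_inrHomeomorph_symm :
    ContMDiffOn 𝓘(ℂ, E) 𝓘(ℂ, E) k (inrHomeomorph e).symm (Set.range (inr e)) := by
  have h : (inrHomeomorph e).symm ∈ IsManifold.maximalAtlas 𝓘(ℂ, E) k (Glued e) :=
    IsManifold.subset_maximalAtlas (Or.inr rfl)
  simpa using contMDiffOn_of_mem_maximalAtlas h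

end Manifold

end Glued

/-! ### Actions of `ℂ²` and their infinitesimal generators. -/

section Action

variable {M : Type} [TopologicalSpace M] [ChartedSpace (ℂ × ℂ) M]

/-- The vector field `d/ds Φ (s v)` at `s = 0` on a manifold with an action of `ℂ²`. -/
noncomputable def infinitesimalGenerator (Φ : ℂ × ℂ → M → M) (v : ℂ × ℂ) (p : M) :
    TangentSpace 𝓘(ℂ, ℂ × ℂ) p :=
  (mfderiv 𝓘(ℂ, ℂ × ℂ) 𝓘(ℂ, ℂ × ℂ) (fun w : ℂ × ℂ => Φ w p) 0 : ℂ × ℂ →L[ℂ] ℂ × ℂ) v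

variable {Φ : ℂ × ℂ → M → M}

theorem mdifferentiableAt_orbitMap
    (hΦ : ContMDiff (𝓘(ℂ, ℂ × ℂ).prod 𝓘(ℂ, ℂ × ℂ)) 𝓘(ℂ, ℂ × ℂ) ω
      (fun q : (ℂ × ℂ) × M => Φ q.1 q.2))
    (p : M) (v : ℂ × ℂ) :
    MDifferentiableAt 𝓘(ℂ, ℂ × ℂ) 𝓘(ℂ, ℂ × ℂ) (fun w : ℂ × ℂ => Φ w p) v := by
  have h : ContMDiff 𝓘(ℂ, ℂ × ℂ) (𝓘(ℂ, ℂ × ℂ).prod 𝓘(ℂ, ℂ × ℂ)) ω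
      (fun w : ℂ × ℂ => (w, p)) := contMDiff_id.prodMk contMDiff_const
  exact ((hΦ.comp h).mdifferentiable (by simp)) v

/-- The generator at `p` is the differential of the action at `(0, p)` applied to `(v, 0)`. It is
thus the tangent map of the action composed with the holomorphic section made of the constant vector
`v` and the zero section. -/
theorem isHolomorphicVectorField_infinitesimalGenerator [IsManifold 𝓘(ℂ, ℂ × ℂ) ω M]
    (hΦ : ContMDiff (𝓘(ℂ, ℂ × ℂ).prod 𝓘(ℂ, ℂ × ℂ)) 𝓘(ℂ, ℂ × ℂ) ω
      (fun q : (ℂ × ℂ) × M => Φ q.1 q.2))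
    (h0 : ∀ p, Φ 0 p = p) (v : ℂ × ℂ) :
    IsHolomorphicVectorField (infinitesimalGenerator Φ v) := by
  let I := 𝓘(ℂ, ℂ × ℂ)
  let fp : M → TangentBundle I M := fun p => Bundle.TotalSpace.mk' (ℂ × ℂ) p 0
  have sfp : ContMDiff I I.tangent ω fp := Bundle.contMDiff_zeroSection _ _
  let fv : M → TangentBundle I (ℂ × ℂ) := fun _ => Bundle.TotalSpace.mk' (ℂ × ℂ) 0 v
  have sfv : ContMDiff I I.tangent ω fv := contMDiff_const
  have S₁ : ContMDiff I (I.tangent.prod I.tangent) ω (fun p => (fv p, fp p)) := sfv.prodMk sfp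
  have S₂ : ContMDiff (I.tangent.prod I.tangent) (I.prod I).tangent ω
      (equivTangentBundleProd I (ℂ × ℂ) I M).symm := contMDiff_equivTangentBundleProd_symm
  have S₃ := ContMDiff.contMDiff_tangentMap (m := ω) hΦ le_rfl
  have S := (S₃.comp S₂).comp S₁
  unfold IsHolomorphicVectorField
  convert! S using 2 with p
  refine Bundle.TotalSpace.ext (h0 p).symm (@heq_of_eq (ℂ × ℂ) _ _ ?_)
  change _ = (mfderiv (I.prod I) I (fun q : (ℂ × ℂ) × M => Φ q.1 q.2) (0, p) :
    (ℂ × ℂ) × (ℂ × ℂ) →L[ℂ] ℂ × ℂ) (v, 0)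
  have h := mfderiv_prod_eq_add_apply (v := ((v, 0) : (ℂ × ℂ) × (ℂ × ℂ)))
    ((hΦ.mdifferentiable (by simp)) ((0 : ℂ × ℂ), p))
  refine Eq.trans ?_ h.symm
  refine Eq.trans (add_zero _).symm (congrArg₂ (fun a b : ℂ × ℂ => a + b) rfl ?_)
  exact (map_zero (mfderiv I I (fun z => Φ 0 z) p : ℂ × ℂ →L[ℂ] ℂ × ℂ)).symm

theorem isHolomorphicActionGeneratedBy_infinitesimalGenerator
    (hΦ : ContMDiff (𝓘(ℂ, ℂ × ℂ).prod 𝓘(ℂ, ℂ × ℂ)) 𝓘(ℂ, ℂ × ℂ) ω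
      (fun q : (ℂ × ℂ) × M => Φ q.1 q.2))
    (h0 : ∀ p, Φ 0 p = p) (hadd : ∀ v w p, Φ (v + w) p = Φ v (Φ w p)) :
    IsHolomorphicActionGeneratedBy Φ (infinitesimalGenerator Φ (1, 0))
      (infinitesimalGenerator Φ (0, 1)) := by
  refine ⟨hΦ, h0, hadd, fun p => ?_⟩
  have key : ∀ L : ℂ × ℂ →L[ℂ] ℂ × ℂ, (ContinuousLinearMap.fst ℂ ℂ ℂ).smulRight (L (1, 0)) +
      (ContinuousLinearMap.snd ℂ ℂ ℂ).smulRight (L (0, 1)) = L := fun L => by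
    ext <;> simp
  exact (mdifferentiableAt_orbitMap hΦ p 0).hasMFDerivAt.congr_mfderiv (key _).symm

/-- The orbit `t ↦ Φ (t v) p` is the integral curve: by the group law `Φ (s v) p = Φ ((s - t) v) (Φ
(t v) p)`, so its velocity at time `t` is the generator at the point reached. -/
theorem isCompleteVectorField_infinitesimalGenerator
    (hΦ : ContMDiff (𝓘(ℂ, ℂ × ℂ).prod 𝓘(ℂ, ℂ × ℂ)) 𝓘(ℂ, ℂ × ℂ) ω
      (fun q : (ℂ × ℂ) × M => Φ q.1 q.2))
    (h0 : ∀ p, Φ 0 p = p) (hadd : ∀ v w p, Φ (v + w) p = Φ v (Φ w p)) (v : ℂ × ℂ) :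
    IsCompleteVectorField (infinitesimalGenerator Φ v) := by
  intro p
  refine ⟨fun t => Φ (t • v) p, by simp [h0], fun t => ?_⟩
  have h2 : HasMFDerivAt 𝓘(ℂ, ℂ) 𝓘(ℂ, ℂ × ℂ) (fun s : ℂ => (s - t) • v) t
      ((ContinuousLinearMap.id ℂ ℂ).smulRight v) :=
    (((hasFDerivAt_id t).sub_const t).smul_const v).hasMFDerivAt
  have h3 : (t - t) • v = 0 := by simp
  have h1 : HasMFDerivAt 𝓘(ℂ, ℂ × ℂ) 𝓘(ℂ, ℂ × ℂ) (fun w : ℂ × ℂ => Φ w (Φ (t • v) p))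
      ((t - t) • v) (mfderiv 𝓘(ℂ, ℂ × ℂ) 𝓘(ℂ, ℂ × ℂ) (fun w : ℂ × ℂ => Φ w (Φ (t • v) p)) 0 :
        ℂ × ℂ →L[ℂ] ℂ × ℂ) := by
    rw [h3]
    exact (mdifferentiableAt_orbitMap hΦ (Φ (t • v) p) 0).hasMFDerivAt
  have h4 := h1.comp t h2
  have h5 : (fun w : ℂ × ℂ => Φ w (Φ (t • v) p)) ∘ (fun s : ℂ => (s - t) • v)
      = fun s => Φ (s • v) p := by
    ext s
    simp only [Function.comp_apply, ← hadd]
    congr 1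
    module
  rw [h5] at h4
  have key : ∀ L : ℂ × ℂ →L[ℂ] ℂ × ℂ, (ContinuousLinearMap.id ℂ ℂ).smulRight (L v) =
      L.comp ((ContinuousLinearMap.id ℂ ℂ).smulRight v) := fun L => by
    ext <;> simp
  exact h4.congr_mfderiv (key _).symm

end Action

/-! ### Holomorphy of an action, read in the copies. -/

section ActionOnCharts

/-- An action map on a gluing is holomorphic at `(v, ι p)`, where `ι` parametrizes one of the two
copies, if it is so when read in the copies. -/
theorem contMDiffAt_of_eventually_eq {M : Type} [TopologicalSpace M] [ChartedSpace (ℂ × ℂ) M]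
    {Φ : ℂ × ℂ → M → M} (c : OpenPartialHomeomorph (ℂ × ℂ) M) {ι : ℂ × ℂ → M}
    {F : (ℂ × ℂ) × (ℂ × ℂ) → ℂ × ℂ} {v p : ℂ × ℂ} (hp : p ∈ c.source)
    (hc : ContMDiffOn 𝓘(ℂ, ℂ × ℂ) 𝓘(ℂ, ℂ × ℂ) ω c.symm c.target)
    (hι : ContMDiff 𝓘(ℂ, ℂ × ℂ) 𝓘(ℂ, ℂ × ℂ) ω ι) (hF : AnalyticAt ℂ F (v, p))
    (h : ∀ᶠ q in 𝓝 (v, p), Φ q.1 (c q.2) = ι (F q)) :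
    ContMDiffAt (𝓘(ℂ, ℂ × ℂ).prod 𝓘(ℂ, ℂ × ℂ)) 𝓘(ℂ, ℂ × ℂ) ω
      (fun q : (ℂ × ℂ) × M => Φ q.1 q.2) (v, c p) := by
  have hcp : c.symm (c p) = p := c.left_inv hp
  have h1 : ContMDiffAt 𝓘(ℂ, ℂ × ℂ) 𝓘(ℂ, ℂ × ℂ) ω c.symm (c p) :=
    hc.contMDiffAt (c.open_target.mem_nhds (c.map_source hp))
  have h2 : ContMDiffAt (𝓘(ℂ, ℂ × ℂ).prod 𝓘(ℂ, ℂ × ℂ)) 𝓘(ℂ, (ℂ × ℂ) × (ℂ × ℂ)) ω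
      (fun q : (ℂ × ℂ) × M => (q.1, c.symm q.2)) (v, c p) :=
    contMDiffAt_fst.prodMk_space (ContMDiffAt.comp (v, c p) h1 contMDiffAt_snd)
  have h3 : ContMDiffAt 𝓘(ℂ, (ℂ × ℂ) × (ℂ × ℂ)) 𝓘(ℂ, ℂ × ℂ) ω F (v, c.symm (c p)) := by
    rw [hcp]
    exact hF.contDiffAt.contMDiffAt
  have h4 := (hι _).comp (v, c p) (ContMDiffAt.comp (v, c p) h3 h2)
  refine h4.congr_of_eventuallyEq ?_
  have h5 : Tendsto (fun q : (ℂ × ℂ) × M => (q.1, c.symm q.2)) (𝓝 (v, c p)) (𝓝 (v, p)) := by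
    have := h2.continuousAt.tendsto
    rwa [hcp] at this
  have h6 : ∀ᶠ q : (ℂ × ℂ) × M in 𝓝 (v, c p), q.2 ∈ c.target :=
    continuousAt_snd.eventually (c.open_target.mem_nhds (c.map_source hp))
  filter_upwards [h5.eventually h, h6] with q hq hq'
  simpa [c.right_inv hq'] using hq

end ActionOnCharts

/-! ### The toric surface: Hausdorff, connected and non-compact. -/

section Toric

theorem zpow_mul_zpow_monomial {x y : ℂ} (hx : x ≠ 0) (hy : y ≠ 0) (i j k l r s : ℤ) :
    (x ^ i * y ^ j) ^ r * (x ^ k * y ^ l) ^ s = x ^ (i * r + k * s) * y ^ (j * r + l * s) := by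
  rw [mul_zpow, mul_zpow, zpow_add₀ hx, zpow_add₀ hy, zpow_mul, zpow_mul, zpow_mul, zpow_mul]
  ring

theorem analyticAt_zpow_mul_zpow {E : Type*} [NormedAddCommGroup E] [NormedSpace ℂ E]
    {F G : E → ℂ} {p : E} (hF : AnalyticAt ℂ F p) (hG : AnalyticAt ℂ G p) (hF0 : F p ≠ 0)
    (hG0 : G p ≠ 0) (i j : ℤ) : AnalyticAt ℂ (fun q => F q ^ i * G q ^ j) p :=
  (hF.fun_zpow hF0).mul (hG.fun_zpow hG0)

/-- The inverse of the pair of monomials `x ^ n * y ^ m`, `x ^ a * y ^ b`, as an automorphism of the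
torus `(ℂ \ {0}) ^ 2`. -/
noncomputable def toricGluing (a b m n : ℕ) (ε : ℤ) (h : (a : ℤ) * m - b * n = ε)
    (hε : ε * ε = 1) : OpenPartialHomeomorph (ℂ × ℂ) (ℂ × ℂ) where
  toFun p := (p.1 ^ (-(n : ℤ)) * p.2 ^ (-(m : ℤ)), p.1 ^ (-(a : ℤ)) * p.2 ^ (-(b : ℤ)))
  -- The exponent matrix of `toFun` has determinant `-ε = ±1`, so its inverse is integral; `ε` plays
  -- the role of `1/ε`.
  invFun q := (q.1 ^ (ε * b) * q.2 ^ (-(ε * m)), q.1 ^ (-(ε * a)) * q.2 ^ (ε * n))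
  source := {p | p.1 ≠ 0 ∧ p.2 ≠ 0}
  target := {p | p.1 ≠ 0 ∧ p.2 ≠ 0}
  map_source' p hp := ⟨mul_ne_zero (zpow_ne_zero _ hp.1) (zpow_ne_zero _ hp.2),
    mul_ne_zero (zpow_ne_zero _ hp.1) (zpow_ne_zero _ hp.2)⟩
  map_target' p hp := ⟨mul_ne_zero (zpow_ne_zero _ hp.1) (zpow_ne_zero _ hp.2),
    mul_ne_zero (zpow_ne_zero _ hp.1) (zpow_ne_zero _ hp.2)⟩
  left_inv' p hp := by
    ext
    · simp only
      rw [zpow_mul_zpow_monomial hp.1 hp.2,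
        show -(n : ℤ) * (ε * b) + -a * -(ε * m) = 1 by linear_combination hε + ε * h,
        show -(m : ℤ) * (ε * b) + -b * -(ε * m) = 0 by ring]
      simp
    · simp only
      rw [zpow_mul_zpow_monomial hp.1 hp.2,
        show -(n : ℤ) * -(ε * a) + -a * (ε * n) = 0 by ring,
        show -(m : ℤ) * -(ε * a) + -b * (ε * n) = 1 by linear_combination hε + ε * h]
      simp
  right_inv' q hq := by
    ext
    · simp only
      rw [zpow_mul_zpow_monomial hq.1 hq.2,
        show ε * b * -(n : ℤ) + -(ε * a) * -m = 1 by linear_combination hε + ε * h,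
        show -(ε * m) * -(n : ℤ) + ε * n * -m = 0 by ring]
      simp
    · simp only
      rw [zpow_mul_zpow_monomial hq.1 hq.2,
        show ε * b * -(a : ℤ) + -(ε * a) * -b = 0 by ring,
        show -(ε * m) * -(a : ℤ) + ε * n * -b = 1 by linear_combination hε + ε * h]
      simp
  open_source := (isOpen_ne_fun continuous_fst continuous_const).inter
    (isOpen_ne_fun continuous_snd continuous_const)
  open_target := (isOpen_ne_fun continuous_fst continuous_const).inter
    (isOpen_ne_fun continuous_snd continuous_const)
  continuousOn_toFun p hp := ((analyticAt_zpow_mul_zpow analyticAt_fst analyticAt_snd hp.1 hp.2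
    _ _).prod (analyticAt_zpow_mul_zpow analyticAt_fst analyticAt_snd hp.1 hp.2
    _ _)).continuousAt.continuousWithinAt
  continuousOn_invFun p hp := ((analyticAt_zpow_mul_zpow analyticAt_fst analyticAt_snd hp.1 hp.2
    _ _).prod (analyticAt_zpow_mul_zpow analyticAt_fst analyticAt_snd hp.1 hp.2
    _ _)).continuousAt.continuousWithinAt

variable {a b m n : ℕ} {ε : ℤ} (h : (a : ℤ) * m - b * n = ε) (hε : ε * ε = 1)

theorem toricGluing_apply (p : ℂ × ℂ) : toricGluing a b m n ε h hε p =
    (p.1 ^ (-(n : ℤ)) * p.2 ^ (-(m : ℤ)), p.1 ^ (-(a : ℤ)) * p.2 ^ (-(b : ℤ))) := rfl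

theorem mem_toricGluing_source {p : ℂ × ℂ} :
    p ∈ (toricGluing a b m n ε h hε).source ↔ p.1 ≠ 0 ∧ p.2 ≠ 0 := Iff.rfl

/-- The complex surface obtained by gluing two copies of `ℂ²` along the monomial automorphism
`toricGluing`. -/
abbrev ToricSurface : Type := Glued (toricGluing a b m n ε h hε)

instance : IsManifold 𝓘(ℂ, ℂ × ℂ) ω (ToricSurface h hε) := by
  refine Glued.isManifold (fun p hp => ?_) fun p hp => ?_
  · exact ((analyticAt_zpow_mul_zpow analyticAt_fst analyticAt_snd hp.1 hp.2
      _ _).prod (analyticAt_zpow_mul_zpow analyticAt_fst analyticAt_snd hp.1 hp.2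
      _ _)).contDiffAt.contDiffWithinAt
  · exact ((analyticAt_zpow_mul_zpow analyticAt_fst analyticAt_snd hp.1 hp.2
      _ _).prod (analyticAt_zpow_mul_zpow analyticAt_fst analyticAt_snd hp.1 hp.2
      _ _)).contDiffAt.contDiffWithinAt

instance : ConnectedSpace (ToricSurface h hε) :=
  Glued.connectedSpace ⟨(1, 1), one_ne_zero, one_ne_zero⟩

instance : SecondCountableTopology (ToricSurface h hε) := Glued.secondCountableTopology

/-- The axes of the first copy are left unglued, and they are unbounded. -/
instance : NoncompactSpace (ToricSurface h hε) := by
  refine Glued.noncompactSpace fun hc => ?_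
  have h1 := hc.image continuous_fst
  have h2 : Prod.fst '' (toricGluing a b m n ε h hε).sourceᶜ = (Set.univ : Set ℂ) := by
    refine Set.eq_univ_of_forall fun x => ⟨(x, 0), fun hx => hx.2 rfl, rfl⟩
  rw [h2] at h1
  exact noncompact_univ ℂ h1

/-- The monomial `x ^ n * y ^ m` vanishes on the complement of the torus, while its inverse is
finite in the second copy. -/
theorem toricSurface_t2Space (hm : 0 < m) (hn : 0 < n) : T2Space (ToricSurface h hε) := by
  refine Glued.t2Space fun p q hp _ => ?_
  refine ⟨{p' | ‖p'.1 ^ n * p'.2 ^ m‖ * (‖q.1‖ + 1) < 1}, {q' | ‖q'.1‖ < ‖q.1‖ + 1},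
    isOpen_lt (by fun_prop) (by fun_prop), isOpen_lt (by fun_prop) (by fun_prop), ?_, ?_, ?_⟩
  · have : p.1 ^ n * p.2 ^ m = 0 := by
      by_contra h0
      exact hp ⟨fun h1 => h0 (by simp [h1, hn.ne']), fun h1 => h0 (by simp [h1, hm.ne'])⟩
    rw [Set.mem_ofPred_eq, this]
    simp
  · simp
  · intro p' hp' hs hq'
    simp only [Set.mem_ofPred_eq, toricGluing_apply] at hp' hq'
    have h1 : (p'.1 ^ n * p'.2 ^ m) * (p'.1 ^ (-(n : ℤ)) * p'.2 ^ (-(m : ℤ))) = 1 := by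
      have h2 := pow_ne_zero n hs.1
      have h3 := pow_ne_zero m hs.2
      rw [zpow_neg, zpow_neg, zpow_natCast, zpow_natCast]
      field_simp
    have h4 := congrArg norm h1
    rw [norm_mul, norm_one] at h4
    have h5 := mul_le_mul_of_nonneg_left hq'.le (norm_nonneg (p'.1 ^ n * p'.2 ^ m))
    linarith

end Toric

/-! ### The action of `ℂ²` on the toric surface. -/

section ToricAction

variable (a b m n : ℕ) (ε : ℤ) (α β ν : ℂ)

/-- The flow on the second copy of `ℂ²` in the toric surface. -/
noncomputable def affineFlow (v q : ℂ × ℂ) : ℂ × ℂ :=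
  (Complex.exp (-(α * v.2)) * q.1 - β * v.2, q.2 - ε * (v.1 + ν * v.2))

/-- The factor by which the monomial `x ^ n * y ^ m` gets divided along the flow. -/
noncomputable def factorU (v p : ℂ × ℂ) : ℂ :=
  Complex.exp (-(α * v.2)) - β * v.2 * (p.1 ^ n * p.2 ^ m)

/-- The factor by which the monomial `x ^ a * y ^ b` gets divided along the flow. -/
noncomputable def factorW (v p : ℂ × ℂ) : ℂ := 1 - ε * (v.1 + ν * v.2) * (p.1 ^ a * p.2 ^ b)

/-- The flow on the first copy of `ℂ²` in the toric surface, where it is defined. -/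
noncomputable def monomialFlow (v p : ℂ × ℂ) : ℂ × ℂ :=
  (p.1 * (factorU m n α β v p ^ (ε * b) * factorW a b ε ν v p ^ (-(ε * m))),
    p.2 * (factorU m n α β v p ^ (-(ε * a)) * factorW a b ε ν v p ^ (ε * n)))

variable {a b m n ε α β ν}

theorem affineFlow_zero (q : ℂ × ℂ) : affineFlow ε α β ν 0 q = q := by
  simp [affineFlow]

/-- The condition `α * β = 0` is what makes `U ↦ exp(-αt) U - βt` a one-parameter group: it is
either a dilation or a translation. -/
theorem affineFlow_add (hαβ : α * β = 0) (v w q : ℂ × ℂ) :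
    affineFlow ε α β ν (v + w) q = affineFlow ε α β ν v (affineFlow ε α β ν w q) := by
  have h1 : Complex.exp (-(α * v.2)) * β = β := by
    rcases mul_eq_zero.1 hαβ with rfl | rfl <;> simp
  ext
  · simp only [affineFlow, Prod.snd_add]
    rw [show -(α * (v.2 + w.2)) = -(α * v.2) + -(α * w.2) by ring, Complex.exp_add]
    linear_combination w.2 * h1
  · simp only [affineFlow, Prod.snd_add, Prod.fst_add]
    ring

theorem analyticAt_affineFlow (z : (ℂ × ℂ) × (ℂ × ℂ)) :
    AnalyticAt ℂ (fun z : (ℂ × ℂ) × (ℂ × ℂ) => affineFlow ε α β ν z.1 z.2) z := by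
  unfold affineFlow
  exact ContDiffAt.analyticAt (by fun_prop)

theorem analyticAt_factorU (z : (ℂ × ℂ) × (ℂ × ℂ)) :
    AnalyticAt ℂ (fun z : (ℂ × ℂ) × (ℂ × ℂ) => factorU m n α β z.1 z.2) z := by
  unfold factorU
  exact ContDiffAt.analyticAt (by fun_prop)

theorem analyticAt_factorW (z : (ℂ × ℂ) × (ℂ × ℂ)) :
    AnalyticAt ℂ (fun z : (ℂ × ℂ) × (ℂ × ℂ) => factorW a b ε ν z.1 z.2) z := by
  unfold factorW
  exact ContDiffAt.analyticAt (by fun_prop)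

theorem analyticAt_monomialFlow (z : (ℂ × ℂ) × (ℂ × ℂ)) (h1 : factorU m n α β z.1 z.2 ≠ 0)
    (h2 : factorW a b ε ν z.1 z.2 ≠ 0) :
    AnalyticAt ℂ (fun z : (ℂ × ℂ) × (ℂ × ℂ) => monomialFlow a b m n ε α β ν z.1 z.2) z := by
  unfold monomialFlow
  refine AnalyticAt.prod (AnalyticAt.mul (ContDiffAt.analyticAt (by fun_prop)) ?_) (AnalyticAt.mul (ContDiffAt.analyticAt (by fun_prop)) ?_)
  · exact analyticAt_zpow_mul_zpow (analyticAt_factorU z) (analyticAt_factorW z) h1 h2 _ _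
  · exact analyticAt_zpow_mul_zpow (analyticAt_factorU z) (analyticAt_factorW z) h1 h2 _ _

theorem monomialFlow_zero (p : ℂ × ℂ) : monomialFlow a b m n ε α β ν 0 p = p := by
  simp [monomialFlow, factorU, factorW]

variable (h : (a : ℤ) * m - b * n = ε) (hε : ε * ε = 1)

/-- The exponents in `monomialFlow` form the inverse of the exponent matrix of `u = x^n y^m`, `w =
x^a y^b`. Hence `u` is divided by `factorU` and `w` by `factorW`, and the reciprocals of `u`, `w`
move by the affine flow. -/
theorem toricGluing_monomialFlow {v p : ℂ × ℂ} (hp : p.1 ≠ 0 ∧ p.2 ≠ 0)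
    (h1 : factorU m n α β v p ≠ 0) (h2 : factorW a b ε ν v p ≠ 0) :
    toricGluing a b m n ε h hε (monomialFlow a b m n ε α β ν v p) =
      affineFlow ε α β ν v (toricGluing a b m n ε h hε p) := by
  have h3 := pow_ne_zero n hp.1
  have h4 := pow_ne_zero m hp.2
  have h5 := pow_ne_zero a hp.1
  have h6 := pow_ne_zero b hp.2
  ext
  · simp only [toricGluing_apply, monomialFlow, affineFlow]
    rw [mul_zpow p.1, mul_zpow p.2, mul_mul_mul_comm, zpow_mul_zpow_monomial h1 h2,
        show ε * b * -(n : ℤ) + -(ε * a) * -m = 1 by linear_combination hε + ε * h,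
        show -(ε * m) * -(n : ℤ) + ε * n * -m = 0 by ring, zpow_one, zpow_zero, factorU]
    simp only [zpow_neg, zpow_natCast]
    field_simp
  · simp only [toricGluing_apply, monomialFlow, affineFlow]
    rw [mul_zpow p.1, mul_zpow p.2, mul_mul_mul_comm, zpow_mul_zpow_monomial h1 h2,
        show ε * b * -(a : ℤ) + -(ε * a) * -b = 0 by ring,
        show -(ε * m) * -(a : ℤ) + ε * n * -b = 1 by linear_combination hε + ε * h,
        zpow_one, zpow_zero, factorW]
    simp only [zpow_neg, zpow_natCast]
    field_simp

theorem monomialFlow_ne_zero {v p : ℂ × ℂ} (hp : p.1 ≠ 0 ∧ p.2 ≠ 0)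
    (h1 : factorU m n α β v p ≠ 0) (h2 : factorW a b ε ν v p ≠ 0) :
    (monomialFlow a b m n ε α β ν v p).1 ≠ 0 ∧ (monomialFlow a b m n ε α β ν v p).2 ≠ 0 :=
  ⟨mul_ne_zero hp.1 (mul_ne_zero (zpow_ne_zero _ h1) (zpow_ne_zero _ h2)),
    mul_ne_zero hp.2 (mul_ne_zero (zpow_ne_zero _ h1) (zpow_ne_zero _ h2))⟩

theorem factorU_of_axis (hm : 0 < m) (hn : 0 < n) {p : ℂ × ℂ} (hp : ¬(p.1 ≠ 0 ∧ p.2 ≠ 0))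
    (v : ℂ × ℂ) : factorU m n α β v p = Complex.exp (-(α * v.2)) := by
  have : p.1 ^ n * p.2 ^ m = 0 := by
    by_contra h0
    exact hp ⟨fun h1 => h0 (by simp [h1, hn.ne']), fun h1 => h0 (by simp [h1, hm.ne'])⟩
  simp [factorU, this]

theorem factorW_of_axis (ha : 0 < a) (hb : 0 < b) {p : ℂ × ℂ} (hp : ¬(p.1 ≠ 0 ∧ p.2 ≠ 0))
    (v : ℂ × ℂ) : factorW a b ε ν v p = 1 := by
  have : p.1 ^ a * p.2 ^ b = 0 := by
    by_contra h0
    exact hp ⟨fun h1 => h0 (by simp [h1, ha.ne']), fun h1 => h0 (by simp [h1, hb.ne'])⟩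
  simp [factorW, this]

/-- Both monomials vanish on the axes, so neither factor can vanish there and the flow exists for
all times. -/
theorem monomialFlow_of_axis (ha : 0 < a) (hb : 0 < b) (hm : 0 < m) (hn : 0 < n) {p : ℂ × ℂ}
    (hp : ¬(p.1 ≠ 0 ∧ p.2 ≠ 0)) (v : ℂ × ℂ) : monomialFlow a b m n ε α β ν v p =
      (p.1 * Complex.exp (-(α * v.2)) ^ (ε * b), p.2 * Complex.exp (-(α * v.2)) ^ (-(ε * a))) := by
  simp [monomialFlow, factorU_of_axis hm hn hp, factorW_of_axis ha hb hp]

theorem monomialFlow_mem_axis {p : ℂ × ℂ} (hp : ¬(p.1 ≠ 0 ∧ p.2 ≠ 0)) (v : ℂ × ℂ) :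
    ¬((monomialFlow a b m n ε α β ν v p).1 ≠ 0 ∧ (monomialFlow a b m n ε α β ν v p).2 ≠ 0) :=
  fun h0 => hp ⟨left_ne_zero_of_mul h0.1, left_ne_zero_of_mul h0.2⟩

variable (α β ν)

open Classical in
/-- The action of `ℂ²` on the toric surface. -/
noncomputable def toricAction (v : ℂ × ℂ) : ToricSurface h hε → ToricSurface h hε
  | Sum.inl p => if p.1 ≠ 0 ∧ p.2 ≠ 0 then
      Glued.inr _ (affineFlow ε α β ν v (toricGluing a b m n ε h hε p))
    else Glued.inl _ (monomialFlow a b m n ε α β ν v p)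
  | Sum.inr q => Glued.inr _ (affineFlow ε α β ν v q.1)

variable {α β ν}

theorem toricAction_inl_of_ne_zero (v : ℂ × ℂ) {p : ℂ × ℂ} (hp : p.1 ≠ 0 ∧ p.2 ≠ 0) :
    toricAction α β ν h hε v (Glued.inl _ p) =
      Glued.inr _ (affineFlow ε α β ν v (toricGluing a b m n ε h hε p)) :=
  if_pos hp

theorem toricAction_inr (v q : ℂ × ℂ) : toricAction α β ν h hε v (Glued.inr _ q) =
    Glued.inr _ (affineFlow ε α β ν v q) := by
  by_cases hq : q ∈ (toricGluing a b m n ε h hε).target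
  · rw [Glued.inr_of_mem hq, toricAction_inl_of_ne_zero h hε v
      ((toricGluing a b m n ε h hε).map_target hq), (toricGluing a b m n ε h hε).right_inv hq]
  · rw [Glued.inr_of_notMem hq]
    rfl

/-- The action is defined piecewise on the first copy. The formula valid on the axes persists
wherever the factors are nonzero, hence on a neighbourhood of the axes, which gives holomorphy
across them. -/
theorem toricAction_inl {v p : ℂ × ℂ} (h1 : factorU m n α β v p ≠ 0)
    (h2 : factorW a b ε ν v p ≠ 0) : toricAction α β ν h hε v (Glued.inl _ p) =
      Glued.inl _ (monomialFlow a b m n ε α β ν v p) := by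
  by_cases hp : p.1 ≠ 0 ∧ p.2 ≠ 0
  · rw [toricAction_inl_of_ne_zero h hε v hp, ← toricGluing_monomialFlow h hε hp h1 h2,
      Glued.inr_apply (monomialFlow_ne_zero hp h1 h2)]
  · exact if_neg hp

theorem toricAction_zero (z : ToricSurface h hε) : toricAction α β ν h hε 0 z = z := by
  rcases Glued.cases z with ⟨p, rfl⟩ | ⟨q, rfl⟩
  · rw [toricAction_inl h hε (by simp [factorU]) (by simp [factorW]), monomialFlow_zero]
  · rw [toricAction_inr, affineFlow_zero]

theorem toricAction_add (ha : 0 < a) (hb : 0 < b) (hm : 0 < m) (hn : 0 < n) (hαβ : α * β = 0)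
    (v w : ℂ × ℂ) (z : ToricSurface h hε) : toricAction α β ν h hε (v + w) z =
      toricAction α β ν h hε v (toricAction α β ν h hε w z) := by
  have key : ∀ q, toricAction α β ν h hε (v + w) (Glued.inr _ q) =
      toricAction α β ν h hε v (toricAction α β ν h hε w (Glued.inr _ q)) := fun q => by
    rw [toricAction_inr, toricAction_inr, toricAction_inr, affineFlow_add hαβ]
  rcases Glued.cases z with ⟨p, rfl⟩ | ⟨q, rfl⟩
  · by_cases hp : p.1 ≠ 0 ∧ p.2 ≠ 0
    · rw [← Glued.inr_apply ((mem_toricGluing_source h hε).2 hp), key]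
    -- The axes are invariant, and there each coordinate is multiplied by a power of `exp(-αt)`.
    · have hU : ∀ v p, ¬(p.1 ≠ 0 ∧ p.2 ≠ 0) → factorU m n α β v p ≠ 0 := fun v p hp => by
        rw [factorU_of_axis hm hn hp]
        exact Complex.exp_ne_zero _
      have hW : ∀ v p, ¬(p.1 ≠ 0 ∧ p.2 ≠ 0) → factorW a b ε ν v p ≠ 0 := fun v p hp => by
        rw [factorW_of_axis ha hb hp]
        exact one_ne_zero
      have hp' := monomialFlow_mem_axis (a := a) (b := b) (m := m) (n := n) (ε := ε) (α := α)
        (β := β) (ν := ν) hp w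
      rw [toricAction_inl h hε (hU _ _ hp) (hW _ _ hp),
        toricAction_inl h hε (hU _ _ hp) (hW _ _ hp),
        toricAction_inl h hε (hU _ _ hp') (hW _ _ hp'), monomialFlow_of_axis ha hb hm hn hp',
        monomialFlow_of_axis ha hb hm hn hp, monomialFlow_of_axis ha hb hm hn hp,
        Prod.snd_add, show -(α * (v.2 + w.2)) = -(α * w.2) + -(α * v.2) by ring, Complex.exp_add,
        mul_zpow, mul_zpow, mul_assoc, mul_assoc]
  · exact key q

/-- In the second copy the action is the affine flow. What remains is the axes of the first copy,
where the factors are nonzero and stay so nearby. -/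
theorem contMDiff_toricAction (ha : 0 < a) (hb : 0 < b) (hm : 0 < m) (hn : 0 < n) :
    ContMDiff (𝓘(ℂ, ℂ × ℂ).prod 𝓘(ℂ, ℂ × ℂ)) 𝓘(ℂ, ℂ × ℂ) ω
      (fun q : (ℂ × ℂ) × ToricSurface h hε => toricAction α β ν h hε q.1 q.2) := by
  have key : ∀ v q, ContMDiffAt (𝓘(ℂ, ℂ × ℂ).prod 𝓘(ℂ, ℂ × ℂ)) 𝓘(ℂ, ℂ × ℂ) ω
      (fun q : (ℂ × ℂ) × ToricSurface h hε => toricAction α β ν h hε q.1 q.2)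
      (v, Glued.inr _ q) := fun v q => by
    refine contMDiffAt_of_eventually_eq (Glued.inrHomeomorph _) (p := q) trivial ?_
      Glued.contMDiff_inr
      (analyticAt_affineFlow (ε := ε) (α := α) (β := β) (ν := ν) (v, q)) ?_
    · rw [Glued.inrHomeomorph_target]
      exact Glued.contMDiffOn_inrHomeomorph_symm
    · exact Eventually.of_forall fun z => toricAction_inr h hε z.1 z.2
  rintro ⟨v, z⟩
  rcases Glued.cases z with ⟨p, rfl⟩ | ⟨q, rfl⟩
  · by_cases hp : p.1 ≠ 0 ∧ p.2 ≠ 0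
    · rw [← Glued.inr_apply ((mem_toricGluing_source h hε).2 hp)]
      exact key _ _
    · have hU : factorU m n α β v p ≠ 0 := by
        rw [factorU_of_axis hm hn hp]
        exact Complex.exp_ne_zero _
      have hW : factorW a b ε ν v p ≠ 0 := by
        rw [factorW_of_axis ha hb hp]
        exact one_ne_zero
      refine contMDiffAt_of_eventually_eq (Glued.inlHomeomorph _) (p := p) trivial ?_
        Glued.contMDiff_inl (analyticAt_monomialFlow (v, p) hU hW) ?_
      · rw [Glued.inlHomeomorph_target]
        exact Glued.contMDiffOn_inlHomeomorph_symm
      · filter_upwards [(analyticAt_factorU (v, p)).continuousAt.eventually_ne hU,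
          (analyticAt_factorW (v, p)).continuousAt.eventually_ne hW] with z h1 h2
        exact toricAction_inl h hε h1 h2
  · exact key v q

end ToricAction

/-! ### Generators of the action in the first copy. -/

section ToricGenerators

variable {a b m n : ℕ} {ε : ℤ} {α β ν : ℂ}

theorem hasDerivAt_zpow_of_eq_one {f : ℂ → ℂ} {f' t : ℂ} (hf : HasDerivAt f f' t) (h1 : f t = 1)
    (k : ℤ) : HasDerivAt (fun s => f s ^ k) (k * f') t := by
  have := (hasDerivAt_zpow k (f t) (Or.inl (by simp [h1]))).comp t hf
  rw [h1, one_zpow, mul_one] at this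
  exact this

/-- Both factors equal `1` at time `0`, so only the exponents and the derivatives of the factors
enter. -/
theorem hasDerivAt_monomialFlow (v p : ℂ × ℂ) :
    HasDerivAt (fun t : ℂ => monomialFlow a b m n ε α β ν (t • v) p)
      (p.1 * (-(ε * b * (α + β * (p.1 ^ n * p.2 ^ m)) * v.2)
          + ε * m * ε * (v.1 + ν * v.2) * (p.1 ^ a * p.2 ^ b)),
        p.2 * (ε * a * (α + β * (p.1 ^ n * p.2 ^ m)) * v.2
          - ε * n * ε * (v.1 + ν * v.2) * (p.1 ^ a * p.2 ^ b))) 0 := by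
  have hU : HasDerivAt (fun t : ℂ => factorU m n α β (t • v) p)
      (-(α + β * (p.1 ^ n * p.2 ^ m)) * v.2) 0 := by
    have h1 : HasDerivAt (fun t : ℂ => Complex.exp (-(α * (t * v.2)))) (-(α * v.2)) 0 := by
      have h0 : HasDerivAt (fun t : ℂ => -(α * (t * v.2))) (-(α * v.2)) 0 := by
        simpa using (((hasDerivAt_id (0 : ℂ)).mul_const v.2).const_mul α).fun_neg
      simpa using h0.cexp
    have h2 : HasDerivAt (fun t : ℂ => β * (t * v.2) * (p.1 ^ n * p.2 ^ m))
        (β * v.2 * (p.1 ^ n * p.2 ^ m)) 0 := by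
      simpa using
        (((hasDerivAt_id (0 : ℂ)).mul_const v.2).const_mul β).mul_const (p.1 ^ n * p.2 ^ m)
    convert! h1.sub h2 using 1
    ring
  have hW : HasDerivAt (fun t : ℂ => factorW a b ε ν (t • v) p)
      (-(ε * (v.1 + ν * v.2) * (p.1 ^ a * p.2 ^ b))) 0 := by
    have h1 : HasDerivAt (fun t : ℂ => 1 - ε * (t * v.1 + ν * (t * v.2)) * (p.1 ^ a * p.2 ^ b))
        (-(ε * (v.1 + ν * v.2) * (p.1 ^ a * p.2 ^ b))) 0 := by
      have h0 := (((hasDerivAt_id (0 : ℂ)).mul_const v.1).add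
        (((hasDerivAt_id (0 : ℂ)).mul_const v.2).const_mul ν))
      simpa using ((h0.const_mul (ε : ℂ)).mul_const (p.1 ^ a * p.2 ^ b)).const_sub 1
    exact h1
  have hU1 : factorU m n α β ((0 : ℂ) • v) p = 1 := by simp [factorU]
  have hW1 : factorW a b ε ν ((0 : ℂ) • v) p = 1 := by simp [factorW]
  have key : ∀ (z : ℂ) (i j : ℤ), HasDerivAt (fun t : ℂ => z *
      (factorU m n α β (t • v) p ^ i * factorW a b ε ν (t • v) p ^ j))
      (z * (i * (-(α + β * (p.1 ^ n * p.2 ^ m)) * v.2)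
        + j * (-(ε * (v.1 + ν * v.2) * (p.1 ^ a * p.2 ^ b))))) 0 := fun z i j => by
    have := ((hasDerivAt_zpow_of_eq_one hU hU1 i).fun_mul
      (hasDerivAt_zpow_of_eq_one hW hW1 j)).const_mul z
    simpa only [hU1, hW1, one_zpow, mul_one, one_mul] using this
  refine HasDerivAt.prodMk ?_ ?_
  · convert! key p.1 (ε * b) (-(ε * m)) using 1
    push_cast
    ring
  · convert! key p.2 (-(ε * a)) (ε * n) using 1
    push_cast
    ring

theorem fderiv_monomialFlow (v p : ℂ × ℂ) :
    fderiv ℂ (fun w => monomialFlow a b m n ε α β ν w p) 0 v =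
      (p.1 * (-(ε * b * (α + β * (p.1 ^ n * p.2 ^ m)) * v.2)
          + ε * m * ε * (v.1 + ν * v.2) * (p.1 ^ a * p.2 ^ b)),
        p.2 * (ε * a * (α + β * (p.1 ^ n * p.2 ^ m)) * v.2
          - ε * n * ε * (v.1 + ν * v.2) * (p.1 ^ a * p.2 ^ b))) := by
  have h1 : AnalyticAt ℂ (fun w => monomialFlow a b m n ε α β ν w p) ((0 : ℂ) • v) := by
    rw [zero_smul]
    exact (analyticAt_monomialFlow (0, p) (by simp [factorU]) (by simp [factorW])).comp
      (f := fun w : ℂ × ℂ => (w, p)) (analyticAt_id.prod analyticAt_const)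
  have h2 := h1.differentiableAt.hasFDerivAt.comp_hasDerivAt (0 : ℂ)
    ((hasDerivAt_id (0 : ℂ)).smul_const v)
  simp only [id_eq, zero_smul, one_smul] at h2
  exact h2.unique (hasDerivAt_monomialFlow v p)

variable (h : (a : ℤ) * m - b * n = ε) (hε : ε * ε = 1)

/-- For small `v` the factors are near `1`, so the orbit stays in the first copy and follows
`monomialFlow`. -/
theorem infinitesimalGenerator_toricAction_inl (v p : ℂ × ℂ) :
    infinitesimalGenerator (toricAction α β ν h hε) v (Glued.inl _ p) =
      (mfderiv 𝓘(ℂ, ℂ × ℂ) 𝓘(ℂ, ℂ × ℂ) (Glued.inl (toricGluing a b m n ε h hε)) p :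
        ℂ × ℂ →L[ℂ] ℂ × ℂ) (fderiv ℂ (fun w => monomialFlow a b m n ε α β ν w p) 0 v) := by
  have hU : factorU m n α β 0 p ≠ 0 := by simp [factorU]
  have hW : factorW a b ε ν 0 p ≠ 0 := by simp [factorW]
  have h1 : (fun w : ℂ × ℂ => toricAction α β ν h hε w (Glued.inl _ p)) =ᶠ[𝓝 0]
      Glued.inl _ ∘ fun w => monomialFlow a b m n ε α β ν w p := by
    have hc : ContinuousAt (fun w : ℂ × ℂ => (w, p)) 0 := by fun_prop
    have hc1 : ContinuousAt (fun w : ℂ × ℂ => factorU m n α β w p) 0 :=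
      ContinuousAt.comp (f := fun w : ℂ × ℂ => (w, p)) (analyticAt_factorU (0, p)).continuousAt hc
    have hc2 : ContinuousAt (fun w : ℂ × ℂ => factorW a b ε ν w p) 0 :=
      ContinuousAt.comp (f := fun w : ℂ × ℂ => (w, p)) (analyticAt_factorW (0, p)).continuousAt hc
    filter_upwards [hc1.eventually_ne hU, hc2.eventually_ne hW] with w h1 h2
    exact toricAction_inl h hε h1 h2
  have h2 : AnalyticAt ℂ (fun w => monomialFlow a b m n ε α β ν w p) 0 :=
    (analyticAt_monomialFlow (0, p) hU hW).comp
      (f := fun w : ℂ × ℂ => (w, p)) (analyticAt_id.prod analyticAt_const)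
  have h3 : HasMFDerivAt 𝓘(ℂ, ℂ × ℂ) 𝓘(ℂ, ℂ × ℂ) (Glued.inl (toricGluing a b m n ε h hε))
      (monomialFlow a b m n ε α β ν 0 p)
      (mfderiv 𝓘(ℂ, ℂ × ℂ) 𝓘(ℂ, ℂ × ℂ) (Glued.inl (toricGluing a b m n ε h hε)) p :
        ℂ × ℂ →L[ℂ] ℂ × ℂ) := by
    rw [monomialFlow_zero]
    exact ((Glued.contMDiff_inl (k := ω)).mdifferentiable (by simp) p).hasMFDerivAt
  have h4 := h3.comp 0 h2.differentiableAt.hasFDerivAt.hasMFDerivAt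
  have h5 := h4.congr_of_eventuallyEq h1
  exact congrArg (fun L : ℂ × ℂ →L[ℂ] ℂ × ℂ => L v) h5.mfderiv

end ToricGenerators

/-! ### Laurent series and normal forms in one variable. -/

section OneVariable

theorem AnalyticAt.exists_eq_mul_of_apply_zero {k : ℂ → ℂ} (hk : AnalyticAt ℂ k 0) (h0 : k 0 = 0) :
    ∃ l : ℂ → ℂ, AnalyticAt ℂ l 0 ∧ ∀ z, k z = z * l z := by
  obtain ⟨p, hp⟩ := hk
  exact ⟨dslope k 0, hp.has_fpower_series_dslope_fslope.analyticAt, fun z => by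
    simpa [h0] using (sub_smul_dslope k 0 z).symm⟩

theorem AnalyticAt.exists_primitive {k : ℂ → ℂ} (hk : AnalyticAt ℂ k 0) :
    ∃ K : ℂ → ℂ, AnalyticAt ℂ K 0 ∧ K 0 = 0 ∧ ∀ᶠ z in 𝓝 0, HasDerivAt K (k z) z := by
  obtain ⟨r, hr, hr'⟩ := Metric.eventually_nhds_iff_ball.1 hk.eventually_analyticAt
  obtain ⟨K, hK0, hK⟩ := (DifferentiableOn.isExactOn_ball (f := k) (c := 0) (r := r)
    fun z hz => (hr' z hz).differentiableAt.differentiableWithinAt).with_val_at 0 0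
  have hb := Metric.ball_mem_nhds (0 : ℂ) hr
  refine ⟨K, ?_, hK0, Filter.eventually_of_mem hb hK⟩
  exact DifferentiableOn.analyticAt (s := Metric.ball 0 r)
    (fun z hz => (hK z hz).differentiableAt.differentiableWithinAt) hb

/-- A Laurent series splits into a finite polar part, with nonzero leading coefficient if it is not
empty, and an analytic function. -/
theorem IsLaurentSeriesAtZero.exists_polar_add_analytic {f : ℂ → ℂ} {c : ℤ → ℂ}
    (hc : IsLaurentSeriesAtZero f c) :
    ∃ (N : ℕ) (k : ℂ → ℂ), (N = 0 ∨ c (-(N : ℤ)) ≠ 0) ∧ AnalyticAt ℂ k 0 ∧ k 0 = c 0 ∧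
      ∀ᶠ z in 𝓝[≠] (0 : ℂ),
        f z = ∑ j ∈ Finset.range N, c (-((j : ℤ) + 1)) * (z ^ (j + 1))⁻¹ + k z := by
  classical
  obtain ⟨⟨N₀, hN₀⟩, hs⟩ := hc
  have hex : ∃ N : ℕ, ∀ k : ℤ, k < -(N : ℤ) → c k = 0 := ⟨N₀, hN₀⟩
  set N := Nat.find hex with hN
  have hN1 : ∀ k : ℤ, k < -(N : ℤ) → c k = 0 := Nat.find_spec hex
  have hN2 : N = 0 ∨ c (-(N : ℤ)) ≠ 0 := by
    by_contra! hcon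
    obtain ⟨M, hM⟩ := Nat.exists_eq_succ_of_ne_zero hcon.1
    refine Nat.find_min hex (m := M) (by omega) fun k hk => ?_
    rcases lt_or_eq_of_le (show k ≤ -(N : ℤ) by push_cast [hM]; omega) with h | rfl
    · exact hN1 k h
    · exact hcon.2
  refine ⟨N, fun z => ∑' i : ℕ, c i * z ^ i, hN2, ?_, ?_, ?_⟩
  · obtain ⟨z, hz, hz0⟩ := (hs.and self_mem_nhdsWithin).exists
    have hsum : Summable fun i : ℕ => c i * z ^ i := by
      simpa [Function.comp_def] using hz.summable.comp_injective Nat.cast_injective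
    set p := FormalMultilinearSeries.ofScalars ℂ (fun i : ℕ => c i) with hp
    -- Convergence at a single nonzero point gives a positive radius.
    have hr : (‖z‖₊ : ENNReal) ≤ p.radius := by
      refine p.le_radius_of_tendsto (l := 0) ?_
      have := hsum.norm.tendsto_atTop_zero
      simpa [hp, FormalMultilinearSeries.ofScalars_norm] using this
    have hr0 : 0 < p.radius := lt_of_lt_of_le (by simpa using hz0) hr
    have := (p.hasFPowerSeriesOnBall hr0).analyticAt
    convert! this using 1
    ext w
    rw [show p.sum = FormalMultilinearSeries.ofScalarsSum (fun i : ℕ => c i) from rfl,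
      FormalMultilinearSeries.ofScalarsSum_eq_tsum]
    simp
  · beta_reduce
    rw [tsum_eq_single 0 (fun i hi => by simp [hi])]
    simp
  · filter_upwards [hs] with z hz
    have hsum : Summable fun i : ℕ => c i * z ^ i := by
      simpa [Function.comp_def] using hz.summable.comp_injective Nat.cast_injective
    have h2 : HasSum (fun i : ℕ => c (-((i : ℤ) + 1)) * z ^ (-((i : ℤ) + 1)))
        (∑ i ∈ Finset.range N, c (-((i : ℤ) + 1)) * z ^ (-((i : ℤ) + 1))) := by
      refine hasSum_sum_of_ne_finset_zero fun i hi => ?_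
      rw [hN1 _ (by simp at hi; omega), zero_mul]
    have h3 := HasSum.of_nat_of_neg_add_one (f := fun k : ℤ => c k * z ^ k)
      (by simpa using hsum.hasSum) h2
    rw [hz.unique h3, add_comm]
    congr 1

/-- The vector field `z * g z * d/dz` is conjugate by a change of variable `z * exp (σ z)` to a
multiple of `z * d/dz` or of `z ^ 2 * d/dz`. -/
theorem exists_linearizing_exponent {g : ℂ → ℂ} {c₀ : ℂ} (hg : AnalyticAt ℂ g 0)
    (hcond : g 0 ≠ 0 ∨ (g 0 = 0 ∧ iteratedDeriv 2 g 0 = 0 ∧ c₀ = 0 ∧ deriv g 0 ≠ 0)) :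
    ∃ (l κ : ℂ) (r σ σ' : ℂ → ℂ), l * κ = 0 ∧ κ * c₀ = 0 ∧ AnalyticAt ℂ r 0 ∧ r 0 = 1 ∧
      AnalyticAt ℂ σ 0 ∧ σ 0 = 0 ∧ (∀ᶠ z in 𝓝 0, HasDerivAt σ (σ' z) z) ∧
      (∀ᶠ z in 𝓝 0, g z * (1 + z * σ' z) = l + κ * (z * Complex.exp (σ z))) ∧
      ∀ᶠ z in 𝓝 0, g z * c₀ * r z = l * c₀ := by
  rcases hcond with h0 | ⟨h0, h2, rfl, h1⟩
  -- Linearization: `σ` solves `1 + z σ' = g 0 / g z`, with `l = g 0` and `κ = 0`.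
  · have hr : AnalyticAt ℂ (fun z => g 0 / g z) 0 := analyticAt_const.div hg h0
    obtain ⟨k, hk, hk'⟩ := (hr.sub (analyticAt_const (v := 1))).exists_eq_mul_of_apply_zero
      (by simp [h0])
    obtain ⟨σ, hσ, hσ0, hσ'⟩ := hk.exists_primitive
    refine ⟨g 0, 0, fun z => g 0 / g z, σ, k, by simp, by simp, hr, by simp [h0], hσ, hσ0, hσ',
      ?_, ?_⟩
    · filter_upwards [hg.continuousAt.eventually_ne h0] with z hz
      rw [← hk']
      simp
      field_simp
    · filter_upwards [hg.continuousAt.eventually_ne h0] with z hz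
      field_simp
  · obtain ⟨g1, hg1, hg1'⟩ := hg.exists_eq_mul_of_apply_zero h0
    obtain ⟨g2, hg2, hg2'⟩ := (hg1.sub (analyticAt_const (v := g1 0))).exists_eq_mul_of_apply_zero
      (by simp)
    have hgz : ∀ z, g z = g1 0 * z + z ^ 2 * g2 z := fun z => by
      have := hg2' z
      simp only [Pi.sub_apply] at this
      rw [hg1']
      linear_combination z * this
    have hd : ∀ᶠ z in 𝓝 (0 : ℂ), HasDerivAt g (g1 0 + (2 * z * g2 z + z ^ 2 * deriv g2 z)) z := by
      filter_upwards [hg2.eventually_analyticAt] with z hz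
      have h3 : HasDerivAt (fun z => g1 0 * z + z ^ 2 * g2 z)
          (g1 0 * 1 + ((2 : ℕ) * z ^ (2 - 1) * g2 z + z ^ 2 * deriv g2 z)) z :=
        ((hasDerivAt_id z).const_mul (g1 0)).add
          ((hasDerivAt_pow 2 z).mul hz.differentiableAt.hasDerivAt)
      rw [← funext hgz] at h3
      simpa using h3
    have hd0 : deriv g 0 = g1 0 := by simpa using hd.self_of_nhds.deriv
    have hd2 : HasDerivAt (deriv g) (2 * g2 0) 0 := by
      have h3 : HasDerivAt (fun z => g1 0 + (2 * z * g2 z + z ^ 2 * deriv g2 z))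
          ((2 * 1 * g2 0 + 2 * 0 * deriv g2 0) +
            ((2 : ℕ) * 0 ^ (2 - 1) * deriv g2 0 + 0 ^ 2 * deriv (deriv g2) 0)) 0 :=
        ((((hasDerivAt_id (0 : ℂ)).const_mul 2).mul hg2.differentiableAt.hasDerivAt).add
          ((hasDerivAt_pow 2 (0 : ℂ)).mul hg2.deriv.differentiableAt.hasDerivAt)).const_add _
      refine (HasDerivAt.congr_of_eventuallyEq ?_ (hd.mono fun z hz => hz.deriv))
      simpa using h3
    -- Here `g''(0) = 0` kills the residue of `1 / (z g)`, the obstruction to reaching `z² d/dz`.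
    have hg20 : g2 0 = 0 := by
      rw [iteratedDeriv_succ, iteratedDeriv_one, hd2.deriv] at h2
      simpa using h2
    obtain ⟨g3, hg3, hg3'⟩ := hg2.exists_eq_mul_of_apply_zero hg20
    rw [hd0] at h1
    have hq : AnalyticAt ℂ (fun z => -g3 z / g1 z) 0 := hg3.neg.div hg1 h1
    -- The new coordinate `v` has `1/v = 1/z - Q`, that is `σ = -log(1 - z Q)`. As `g = z g1` and
    -- `g1 = g1 0 + z² g3`, the field `z g d/dz` sends `1/v` to the constant `-g1 0`.
    obtain ⟨Q, hQ, hQ0, hQ'⟩ := hq.exists_primitive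
    have hD : AnalyticAt ℂ (fun z => 1 - z * Q z) 0 := analyticAt_const.sub (analyticAt_id.mul hQ)
    have hS : ∀ᶠ z in 𝓝 (0 : ℂ), 1 - z * Q z ∈ Complex.slitPlane :=
      hD.continuousAt.eventually (Complex.isOpen_slitPlane.mem_nhds (by simp))
    refine ⟨0, g1 0, fun _ => 1, fun z => -Complex.log (1 - z * Q z),
      fun z => (Q z + z * (-g3 z / g1 z)) / (1 - z * Q z), by simp, by simp, analyticAt_const, rfl,
      (hD.clog (by simp)).neg, by simp, ?_, ?_, by simp⟩
    · filter_upwards [hQ', hS] with z hz hz'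
      have h3 : HasDerivAt (fun z => 1 - z * Q z) (-(1 * Q z + z * (-g3 z / g1 z))) z :=
        ((hasDerivAt_id z).mul hz).const_sub 1
      convert! (h3.clog hz').fun_neg using 1
      ring
    · filter_upwards [hS, hg1.continuousAt.eventually_ne h1] with z hz hz'
      have hz0 : 1 - z * Q z ≠ 0 := Complex.slitPlane_ne_zero hz
      rw [Complex.exp_neg, Complex.exp_log hz0, hg1']
      have h3 := hg2' z
      simp only [Pi.sub_apply] at h3
      rw [hg3'] at h3
      field_simp
      linear_combination z * h3

end OneVariable

/-! ### The pole of `f` is controlled by the monomial `x^a y^b`. -/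

section PolarPart

/-- If `x ^ a * y ^ b * u ^ (-N) * q u`, with `u = x ^ n * y ^ m` and `q 0 ≠ 0`, is bounded near the
origin, then `n * N ≤ a`. -/
theorem mul_le_of_mul_eq_monomial_mul {F : ℂ × ℂ → ℂ} {q : ℂ → ℂ} {a b m n N : ℕ} (hn : 0 < n)
    (hF : ∀ᶠ p in 𝓝 (0 : ℂ × ℂ), ContinuousAt F p) (hq : ContinuousAt q 0) (hq0 : q 0 ≠ 0)
    (h : ∀ᶠ p in 𝓝 (0 : ℂ × ℂ), p.1 ≠ 0 → p.2 ≠ 0 →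
      F p * (p.1 ^ n * p.2 ^ m) ^ N = p.1 ^ a * p.2 ^ b * q (p.1 ^ n * p.2 ^ m)) :
    n * N ≤ a := by
  by_contra! hlt
  -- Fix a small `y ≠ 0` and let `x → 0`: if `a < n * N`, then after division by `x^a` the left side
  -- tends to `0` and the right side to `y^b q(0) ≠ 0`.
  have hy : Tendsto (fun y : ℂ => ((0 : ℂ), y)) (𝓝[≠] 0) (𝓝 0) :=
    ((by fun_prop : Continuous fun y : ℂ => ((0 : ℂ), y)).tendsto' 0 0 rfl).mono_left
      nhdsWithin_le_nhds
  obtain ⟨y, ⟨hFy, hy1⟩, hy0⟩ :=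
    ((hy.eventually (hF.and h.eventually_nhds)).and self_mem_nhdsWithin).exists
  have hy0 : y ≠ 0 := hy0
  have hx : Tendsto (fun x : ℂ => (x, y)) (𝓝 0) (𝓝 ((0 : ℂ), y)) :=
    (by fun_prop : Continuous fun x : ℂ => (x, y)).tendsto' _ _ rfl
  have h1 : ∀ᶠ x in 𝓝[≠] (0 : ℂ),
      F (x, y) * (x ^ (n * N - a) * y ^ (m * N)) = y ^ b * q (x ^ n * y ^ m) := by
    filter_upwards [nhdsWithin_le_nhds (hx.eventually hy1), self_mem_nhdsWithin] with x hx1 hx0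
    have h2 := hx1 hx0 hy0
    have hxa : x ^ a ≠ 0 := pow_ne_zero _ hx0
    refine mul_left_cancel₀ hxa ?_
    have h3 : x ^ a * x ^ (n * N - a) = x ^ (n * N) := by rw [← pow_add]; congr 1; omega
    rw [mul_pow, ← pow_mul, ← pow_mul] at h2
    linear_combination h2 + F (x, y) * y ^ (m * N) * h3
  have hl : Tendsto (fun x : ℂ => F (x, y) * (x ^ (n * N - a) * y ^ (m * N))) (𝓝 0) (𝓝 0) := by
    have h4 : Tendsto (fun x : ℂ => x ^ (n * N - a) * y ^ (m * N)) (𝓝 0) (𝓝 0) :=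
      (by fun_prop : Continuous fun x : ℂ => x ^ (n * N - a) * y ^ (m * N)).tendsto' _ _
        (by simp [(Nat.sub_pos_of_lt hlt).ne'])
    simpa using (hFy.tendsto.comp hx).mul h4
  have hr : Tendsto (fun x : ℂ => y ^ b * q (x ^ n * y ^ m)) (𝓝 0) (𝓝 (y ^ b * q 0)) := by
    refine (hq.tendsto.comp ?_).const_mul _
    exact (by fun_prop : Continuous fun x : ℂ => x ^ n * y ^ m).tendsto' _ _ (by simp [hn.ne'])
  have h5 := tendsto_nhds_unique ((hl.mono_left nhdsWithin_le_nhds).congr' h1)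
    (hr.mono_left nhdsWithin_le_nhds)
  exact mul_ne_zero (pow_ne_zero b hy0) hq0 h5.symm

theorem eventually_monomial_ne_zero {n m : ℕ} (hn : 0 < n) {P : ℂ → Prop}
    (h : ∀ᶠ z in 𝓝[≠] (0 : ℂ), P z) : ∀ᶠ p in 𝓝 (0 : ℂ × ℂ), p.1 ≠ 0 → p.2 ≠ 0 →
      P (p.1 ^ n * p.2 ^ m) := by
  rw [eventually_nhdsWithin_iff] at h
  have hu : Tendsto (fun p : ℂ × ℂ => p.1 ^ n * p.2 ^ m) (𝓝 0) (𝓝 0) :=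
    (by fun_prop : Continuous fun p : ℂ × ℂ => p.1 ^ n * p.2 ^ m).tendsto' _ _ (by simp [hn.ne'])
  filter_upwards [hu.eventually h] with p hp h1 h2
  exact hp (mul_ne_zero (pow_ne_zero _ h1) (pow_ne_zero _ h2))

/-- The complement of the axes is dense, so continuity propagates the equality. -/
theorem eventually_eq_of_eq_off_axes {F G : ℂ × ℂ → ℂ}
    (hF : ∀ᶠ p in 𝓝 (0 : ℂ × ℂ), ContinuousAt F p) (hG : ∀ᶠ p in 𝓝 (0 : ℂ × ℂ), ContinuousAt G p)
    (h : ∀ᶠ p in 𝓝 (0 : ℂ × ℂ), p.1 ≠ 0 → p.2 ≠ 0 → F p = G p) :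
    ∀ᶠ p in 𝓝 (0 : ℂ × ℂ), F p = G p := by
  have hd : Dense (({0}ᶜ : Set ℂ) ×ˢ ({0}ᶜ : Set ℂ)) :=
    (dense_compl_singleton 0).prod (dense_compl_singleton 0)
  filter_upwards [hF, hG, h.eventually_nhds] with p h1 h2 h3
  have : (𝓝[({0}ᶜ : Set ℂ) ×ˢ ({0}ᶜ : Set ℂ)] p).NeBot := mem_closure_iff_nhdsWithin_neBot.1 (hd p)
  refine tendsto_nhds_unique ((h1.tendsto.mono_left
    (nhdsWithin_le_nhds (s := ({0}ᶜ : Set ℂ) ×ˢ ({0}ᶜ : Set ℂ)))).congr' ?_)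
    (h2.tendsto.mono_left nhdsWithin_le_nhds)
  filter_upwards [nhdsWithin_le_nhds h3, self_mem_nhdsWithin] with q hq hq'
  exact hq hq'.1 hq'.2

/-- The sum of a polar part `∑ c (-j) * u ^ (-j)` multiplied by `x ^ a * y ^ b`. -/
def polarMonomials (a b m n N : ℕ) (c : ℕ → ℂ) (p : ℂ × ℂ) : ℂ :=
  -- The truncated subtractions are genuine once `n * N ≤ a` and `m * N ≤ b`.
  ∑ j ∈ Finset.range N, c j * (p.1 ^ (a - n * (j + 1)) * p.2 ^ (b - m * (j + 1)))

theorem analyticAt_polarMonomials (a b m n N : ℕ) (c : ℕ → ℂ) (p : ℂ × ℂ) :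
    AnalyticAt ℂ (polarMonomials a b m n N c) p := by
  unfold polarMonomials
  exact ContDiffAt.analyticAt (by fun_prop)

theorem monomial_mul_inv_eq {a b m n N j : ℕ} (h1 : n * N ≤ a) (h2 : m * N ≤ b) (hj : j < N)
    {x y : ℂ} (hx : x ≠ 0) (hy : y ≠ 0) : x ^ a * y ^ b * ((x ^ n * y ^ m) ^ (j + 1))⁻¹ =
      x ^ (a - n * (j + 1)) * y ^ (b - m * (j + 1)) := by
  have h3 : n * (j + 1) ≤ a := (Nat.mul_le_mul_left n hj).trans h1
  have h4 : m * (j + 1) ≤ b := (Nat.mul_le_mul_left m hj).trans h2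
  rw [mul_pow, ← pow_mul, ← pow_mul, mul_inv_eq_iff_eq_mul₀ (by positivity), mul_mul_mul_comm,
    ← pow_add, ← pow_add, Nat.sub_add_cancel h3, Nat.sub_add_cancel h4]

/-- Boundedness of `F` near the axes bounds the pole order of `f`, so each polar term times `x^a
y^b` is a genuine monomial. -/
theorem IsHolomorphicExtension.exists_polarMonomials {a b m n : ℕ} (hm : 0 < m) (hn : 0 < n)
    {f : ℂ → ℂ} {F : ℂ × ℂ → ℂ} {c : ℤ → ℂ} (hF : IsHolomorphicExtension a b m n f F)
    (hc : IsLaurentSeriesAtZero f c) :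
    ∃ (N : ℕ) (k : ℂ → ℂ), n * N ≤ a ∧ m * N ≤ b ∧ AnalyticAt ℂ k 0 ∧ k 0 = c 0 ∧
      ∀ᶠ p in 𝓝 (0 : ℂ × ℂ), F p = polarMonomials a b m n N (fun j => c (-((j : ℤ) + 1))) p +
        p.1 ^ a * p.2 ^ b * k (p.1 ^ n * p.2 ^ m) := by
  obtain ⟨N, k, hN, hk, hk0, hfk⟩ := hc.exists_polar_add_analytic
  obtain ⟨hFa, -, hFe⟩ := hF
  have hFc : ∀ᶠ p in 𝓝 (0 : ℂ × ℂ), ContinuousAt F p :=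
    hFa.eventually_analyticAt.mono fun p hp => hp.continuousAt
  have hfu := eventually_monomial_ne_zero (m := m) hn hfk
  have hbound : n * N ≤ a ∧ m * N ≤ b := by
    rcases Nat.eq_zero_or_pos N with rfl | hN0
    · simp
    replace hN := hN.resolve_left hN0.ne'
    -- This is `z^N f(z)`, with the pole cleared; its value at `0` is the leading Laurent
    -- coefficient.
    let q : ℂ → ℂ := fun z =>
      ∑ j ∈ Finset.range N, c (-((j : ℤ) + 1)) * z ^ (N - (j + 1)) + z ^ N * k z
    have hqc : ContinuousAt q 0 := by
      have := hk.continuousAt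
      fun_prop
    have hq0 : q 0 ≠ 0 := by
      obtain ⟨M, rfl⟩ := Nat.exists_eq_succ_of_ne_zero hN0.ne'
      have : q 0 = c (-((M.succ : ℕ) : ℤ)) := by
        simp only [q, Nat.succ_eq_add_one]
        rw [Finset.sum_range_succ, Finset.sum_eq_zero]
        · simp
        · intro j hj
          have : M + 1 - (j + 1) ≠ 0 := by simp at hj; omega
          rw [zero_pow this, mul_zero]
      rwa [this]
    have hrel : ∀ᶠ p in 𝓝 (0 : ℂ × ℂ), p.1 ≠ 0 → p.2 ≠ 0 →
        F p * (p.1 ^ n * p.2 ^ m) ^ N = p.1 ^ a * p.2 ^ b * q (p.1 ^ n * p.2 ^ m) := by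
      filter_upwards [hFe, hfu] with p h1 h2 hx hy
      have hu : p.1 ^ n * p.2 ^ m ≠ 0 := mul_ne_zero (pow_ne_zero _ hx) (pow_ne_zero _ hy)
      rw [h1 hx hy, h2 hx hy, mul_assoc]
      congr 1
      simp only [q]
      rw [add_mul, Finset.sum_mul, mul_comm (k _)]
      congr 1
      refine Finset.sum_congr rfl fun j hj => ?_
      rw [mul_assoc, pow_sub₀ _ hu (by simp at hj; omega), mul_comm (_ ^ N)]
    refine ⟨mul_le_of_mul_eq_monomial_mul hn hFc hqc hq0 hrel, ?_⟩
    -- The bound on `m * N` is the same statement with the two coordinates exchanged.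
    have hs : Tendsto (Prod.swap : ℂ × ℂ → ℂ × ℂ) (𝓝 0) (𝓝 0) :=
      continuous_swap.tendsto' 0 0 rfl
    refine mul_le_of_mul_eq_monomial_mul (F := F ∘ Prod.swap) (b := a) (m := n) hm ?_ hqc hq0 ?_
    · exact (hs.eventually hFc).mono fun p hp => hp.comp continuous_swap.continuousAt
    · filter_upwards [hs.eventually hrel] with p hp hx hy
      have := hp hy hx
      simp only [Prod.fst_swap, Prod.snd_swap] at this
      rw [Function.comp_apply, mul_comm (p.1 ^ m), this, mul_comm (p.1 ^ b)]
  refine ⟨N, k, hbound.1, hbound.2, hk, hk0, eventually_eq_of_eq_off_axes hFc ?_ ?_⟩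
  · have hu : Tendsto (fun p : ℂ × ℂ => p.1 ^ n * p.2 ^ m) (𝓝 0) (𝓝 0) :=
      (by fun_prop : Continuous fun p : ℂ × ℂ => p.1 ^ n * p.2 ^ m).tendsto' _ _
        (by simp [hn.ne'])
    filter_upwards [hu.eventually hk.eventually_analyticAt] with p hp
    refine (analyticAt_polarMonomials _ _ _ _ _ _ p).continuousAt.add (ContinuousAt.mul
      (by fun_prop) (ContinuousAt.comp (g := k) hp.continuousAt (by fun_prop)))
  · filter_upwards [hFe, hfu] with p h1 h2 hx hy
    rw [h1 hx hy, h2 hx hy, mul_add, polarMonomials, Finset.mul_sum]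
    congr 1
    refine Finset.sum_congr rfl fun j hj => ?_
    rw [← monomial_mul_inv_eq hbound.1 hbound.2 (Finset.mem_range.1 hj) hx hy]
    ring

end PolarPart

/-! ### The straightening change of coordinates and its derivative. -/

section Conjugation

theorem HasDerivAt.monomial {γ₁ γ₂ : ℂ → ℂ} {x y ξ η t : ℂ} (h1 : HasDerivAt γ₁ (x * ξ) t)
    (h2 : HasDerivAt γ₂ (y * η) t) (hx : γ₁ t = x) (hy : γ₂ t = y) (i j : ℕ) :
    HasDerivAt (fun s => γ₁ s ^ i * γ₂ s ^ j) ((i * ξ + j * η) * (x ^ i * y ^ j)) t := by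
  have key : ∀ {γ : ℂ → ℂ} {x ξ : ℂ} (i : ℕ), HasDerivAt γ (x * ξ) t → γ t = x →
      HasDerivAt (fun s => γ s ^ i) (i * ξ * x ^ i) t := by
    intro γ x ξ i h hx
    convert! h.fun_pow i using 1
    rw [hx]
    cases i with
    | zero => simp
    | succ i => simp [pow_succ]; ring
  convert! (key i h1 hx).fun_mul (key j h2 hy) using 1
  rw [hx, hy]
  ring

variable (a b m n N : ℕ) (c : ℕ → ℂ) (ε : ℂ) (K σ : ℂ → ℂ)

/-- The function `x ^ a * y ^ b * h (x ^ n * y ^ m)`, where `h` is a meromorphic primitive. -/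
noncomputable def correction (p : ℂ × ℂ) : ℂ :=
  -- Along `Y`, `u` has logarithmic derivative `ε m g` and `1/w` has derivative `-(ε/m) g f`; their
  -- quotient produces `ε / m²`. The term `c j u^(-(j+1))` is integrated against `du/u`.
  ε / m ^ 2 * (polarMonomials a b m n N (fun j => -(c j / (j + 1))) p +
    p.1 ^ a * p.2 ^ b * K (p.1 ^ n * p.2 ^ m))

/-- The change of coordinates which multiplies `x ^ n * y ^ m` by `exp (σ (x ^ n * y ^ m))` and
divides `x ^ a * y ^ b` by `1 + ε * correction`. -/
noncomputable def straightening (p : ℂ × ℂ) : ℂ × ℂ :=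
  (p.1 * Complex.exp (-(ε * (b * σ (p.1 ^ n * p.2 ^ m)
      + m * Complex.log (1 + ε * correction a b m n N c ε K p)))),
    p.2 * Complex.exp (ε * (a * σ (p.1 ^ n * p.2 ^ m)
      + n * Complex.log (1 + ε * correction a b m n N c ε K p))))

variable {a b m n N c ε K σ}

theorem analyticAt_comp_monomial {k : ℂ → ℂ} {p : ℂ × ℂ} (hk : AnalyticAt ℂ k (p.1 ^ n * p.2 ^ m)) :
    AnalyticAt ℂ (fun q : ℂ × ℂ => k (q.1 ^ n * q.2 ^ m)) p :=
  hk.comp_of_eq (ContDiffAt.analyticAt (f := fun q : ℂ × ℂ => q.1 ^ n * q.2 ^ m) (by fun_prop)) rfl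

theorem analyticAt_correction {p : ℂ × ℂ} (hK : AnalyticAt ℂ K (p.1 ^ n * p.2 ^ m)) :
    AnalyticAt ℂ (correction a b m n N c ε K) p := by
  refine analyticAt_const.mul ((analyticAt_polarMonomials _ _ _ _ _ _ p).add (AnalyticAt.mul
    (ContDiffAt.analyticAt (by fun_prop)) (analyticAt_comp_monomial hK)))

theorem analyticAt_straightening_factor {p : ℂ × ℂ} (hK : AnalyticAt ℂ K (p.1 ^ n * p.2 ^ m))
    (hσ : AnalyticAt ℂ σ (p.1 ^ n * p.2 ^ m))
    (hs : 1 + ε * correction a b m n N c ε K p ∈ Complex.slitPlane) (i j : ℂ) :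
    AnalyticAt ℂ (fun p => Complex.exp (ε * (i * σ (p.1 ^ n * p.2 ^ m)
      + j * Complex.log (1 + ε * correction a b m n N c ε K p)))) p := by
  have h1 := analyticAt_comp_monomial hσ
  have h2 := (analyticAt_const (v := (1 : ℂ))).fun_add
    ((analyticAt_const (v := ε)).fun_mul (analyticAt_correction (a := a) (b := b) (N := N)
      (c := c) (ε := ε) hK))
  exact (analyticAt_const.mul ((analyticAt_const.mul h1).add (analyticAt_const.mul
    (h2.clog hs)))).cexp

theorem analyticAt_straightening {p : ℂ × ℂ} (hK : AnalyticAt ℂ K (p.1 ^ n * p.2 ^ m))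
    (hσ : AnalyticAt ℂ σ (p.1 ^ n * p.2 ^ m))
    (hs : 1 + ε * correction a b m n N c ε K p ∈ Complex.slitPlane) :
    AnalyticAt ℂ (straightening a b m n N c ε K σ) p := by
  refine (analyticAt_fst.mul ?_).prod
    (analyticAt_snd.mul (analyticAt_straightening_factor hK hσ hs _ _))
  convert! analyticAt_straightening_factor hK hσ hs (-b) (-m) using 3
  ring

/-- Velocities are written `(x ξ, y η)` because a monomial `x^i y^j` then has derivative `iξ + jη`
times itself. The result is the product rule for `w h(u)`, done term by term so as to stay valid on
the axes. -/
theorem hasDerivAt_correction {γ : ℂ → ℂ × ℂ} {x y ξ η t d : ℂ}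
    (h1 : HasDerivAt (fun s => (γ s).1) (x * ξ) t) (h2 : HasDerivAt (fun s => (γ s).2) (y * η) t)
    (hγ : γ t = (x, y)) (hK : HasDerivAt K d (x ^ n * y ^ m)) (ha : n * N ≤ a) (hb : m * N ≤ b) :
    HasDerivAt (fun s => correction a b m n N c ε K (γ s))
      ((a * ξ + b * η) * correction a b m n N c ε K (x, y) +
        ε / m ^ 2 * (n * ξ + m * η) * (polarMonomials a b m n N c (x, y) +
          x ^ a * y ^ b * (x ^ n * y ^ m * d))) t := by
  have hx : (γ t).1 = x := by rw [hγ]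
  have hy : (γ t).2 = y := by rw [hγ]
  have hu := h1.monomial h2 hx hy n m
  have hw := h1.monomial h2 hx hy a b
  have hKu : HasDerivAt (fun s => K ((γ s).1 ^ n * (γ s).2 ^ m)) _ t :=
    HasDerivAt.comp t (h₂ := K) (by rwa [hx, hy]) hu
  have hP : HasDerivAt (fun s => polarMonomials a b m n N (fun j => -(c j / (j + 1))) (γ s))
      (∑ j ∈ Finset.range N, -(c j / (j + 1)) *
        (((a - n * (j + 1) : ℕ) * ξ + (b - m * (j + 1) : ℕ) * η) *
          (x ^ (a - n * (j + 1)) * y ^ (b - m * (j + 1))))) t :=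
    HasDerivAt.fun_sum fun j _ => (h1.monomial h2 hx hy _ _).const_mul _
  have hP' : ∑ j ∈ Finset.range N, -(c j / (j + 1)) *
        (((a - n * (j + 1) : ℕ) * ξ + (b - m * (j + 1) : ℕ) * η) *
          (x ^ (a - n * (j + 1)) * y ^ (b - m * (j + 1)))) =
      (a * ξ + b * η) * polarMonomials a b m n N (fun j => -(c j / (j + 1))) (x, y) +
        (n * ξ + m * η) * polarMonomials a b m n N c (x, y) := by
    rw [polarMonomials, polarMonomials, Finset.mul_sum, Finset.mul_sum, ← Finset.sum_add_distrib]
    refine Finset.sum_congr rfl fun j hj => ?_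
    have hj' : j + 1 ≤ N := Finset.mem_range.1 hj
    rw [Nat.cast_sub ((Nat.mul_le_mul_left n hj').trans ha),
      Nat.cast_sub ((Nat.mul_le_mul_left m hj').trans hb)]
    have hj0 : (j : ℂ) + 1 ≠ 0 := by exact_mod_cast j.succ_ne_zero
    push_cast
    field_simp
    ring
  rw [hP'] at hP
  convert! (hP.fun_add (hw.fun_mul hKu)).const_mul (ε / m ^ 2) using 1
  rw [correction, hx, hy]
  ring

theorem hasDerivAt_straightening {γ : ℂ → ℂ × ℂ} {x y ξ η t s' H' : ℂ}
    (h1 : HasDerivAt (fun s => (γ s).1) (x * ξ) t) (h2 : HasDerivAt (fun s => (γ s).2) (y * η) t)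
    (hγ : γ t = (x, y)) (hσ : HasDerivAt σ s' (x ^ n * y ^ m))
    (hs : 1 + ε * correction a b m n N c ε K (x, y) ∈ Complex.slitPlane)
    (hH : HasDerivAt (fun s => correction a b m n N c ε K (γ s)) H' t) :
    HasDerivAt (fun s => straightening a b m n N c ε K σ (γ s))
      ((straightening a b m n N c ε K σ (x, y)).1 * (ξ - ε * (b * (s' * ((n * ξ + m * η) *
          (x ^ n * y ^ m))) + m * (ε * H' / (1 + ε * correction a b m n N c ε K (x, y))))),
        (straightening a b m n N c ε K σ (x, y)).2 * (η + ε * (a * (s' * ((n * ξ + m * η) *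
          (x ^ n * y ^ m))) + n * (ε * H' / (1 + ε * correction a b m n N c ε K (x, y)))))) t := by
  have hx : (γ t).1 = x := by rw [hγ]
  have hy : (γ t).2 = y := by rw [hγ]
  have hu := h1.monomial h2 hx hy n m
  have hσu : HasDerivAt (fun s => σ ((γ s).1 ^ n * (γ s).2 ^ m)) _ t :=
    HasDerivAt.comp t (h₂ := σ) (by rwa [hx, hy]) hu
  have hL : HasDerivAt (fun s => Complex.log (1 + ε * correction a b m n N c ε K (γ s)))
      (ε * H' / (1 + ε * correction a b m n N c ε K (x, y))) t := by
    have := ((hH.const_mul ε).const_add 1).clog (by rwa [hγ])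
    rwa [hγ] at this
  refine HasDerivAt.prodMk ?_ ?_
  · convert! h1.fun_mul ((((hσu.const_mul (b : ℂ)).fun_add
      (hL.const_mul (m : ℂ))).const_mul ε).fun_neg.cexp) using 1
    rw [hγ]
    simp only [straightening]
    ring
  · convert! h2.fun_mul ((((hσu.const_mul (a : ℂ)).fun_add
      (hL.const_mul (n : ℂ))).const_mul ε).cexp) using 1
    rw [hγ]
    simp only [straightening]
    ring

/-- In the exponent the logarithms cancel and `σ` gets the coefficient `ε (am - bn) = 1`. -/
theorem straightening_monomial_nm (h : (a : ℂ) * m - b * n = ε) (hε : ε * ε = 1) (p : ℂ × ℂ) :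
    (straightening a b m n N c ε K σ p).1 ^ n * (straightening a b m n N c ε K σ p).2 ^ m =
      p.1 ^ n * p.2 ^ m * Complex.exp (σ (p.1 ^ n * p.2 ^ m)) := by
  simp only [straightening]
  rw [mul_pow, mul_pow, ← Complex.exp_nat_mul, ← Complex.exp_nat_mul, mul_mul_mul_comm,
    ← Complex.exp_add]
  congr 2
  linear_combination (ε * σ (p.1 ^ n * p.2 ^ m)) * h + σ (p.1 ^ n * p.2 ^ m) * hε

theorem straightening_monomial_ab (h : (a : ℂ) * m - b * n = ε) (hε : ε * ε = 1) {p : ℂ × ℂ}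
    (hp : 1 + ε * correction a b m n N c ε K p ≠ 0) :
    (straightening a b m n N c ε K σ p).1 ^ a * (straightening a b m n N c ε K σ p).2 ^ b =
      p.1 ^ a * p.2 ^ b / (1 + ε * correction a b m n N c ε K p) := by
  simp only [straightening]
  set L := Complex.log (1 + ε * correction a b m n N c ε K p) with hL
  rw [mul_pow, mul_pow, ← Complex.exp_nat_mul, ← Complex.exp_nat_mul, mul_mul_mul_comm,
    ← Complex.exp_add, div_eq_mul_inv]
  congr 1
  rw [← Complex.exp_log hp, ← Complex.exp_neg, ← hL]
  congr 1
  linear_combination (-ε * L) * h - L * hε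

theorem fderiv_eq_of_hasDerivAt_line {θ : ℂ × ℂ → ℂ × ℂ} {p v d : ℂ × ℂ}
    (hθ : DifferentiableAt ℂ θ p) (h : HasDerivAt (fun t : ℂ => θ (p + t • v)) d 0) :
    fderiv ℂ θ p v = d :=
  HasLineDerivAt.unique (hθ.hasFDerivAt.hasLineDerivAt v) h

end Conjugation

/-! ### Reduction of the two fields to polynomial normal forms. -/

section ConjugationOfVectorFields

variable {a b m n N : ℕ} {c : ℕ → ℂ} {ε : ℂ} {K σ : ℂ → ℂ}

theorem fderiv_straightening {p : ℂ × ℂ} {ξ η s' d : ℂ}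
    (hK : AnalyticAt ℂ K (p.1 ^ n * p.2 ^ m)) (hK' : HasDerivAt K d (p.1 ^ n * p.2 ^ m))
    (hσ : AnalyticAt ℂ σ (p.1 ^ n * p.2 ^ m)) (hσ' : HasDerivAt σ s' (p.1 ^ n * p.2 ^ m))
    (hs : 1 + ε * correction a b m n N c ε K p ∈ Complex.slitPlane)
    (ha : n * N ≤ a) (hb : m * N ≤ b) :
    let H := correction a b m n N c ε K p
    let H' := (a * ξ + b * η) * H + ε / m ^ 2 * (n * ξ + m * η) * (polarMonomials a b m n N c p +
          p.1 ^ a * p.2 ^ b * (p.1 ^ n * p.2 ^ m * d))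
    fderiv ℂ (straightening a b m n N c ε K σ) p (p.1 * ξ, p.2 * η) =
      ((straightening a b m n N c ε K σ p).1 * (ξ - ε * (b * (s' * ((n * ξ + m * η) *
          (p.1 ^ n * p.2 ^ m))) + m * (ε * H' / (1 + ε * H)))),
        (straightening a b m n N c ε K σ p).2 * (η + ε * (a * (s' * ((n * ξ + m * η) *
          (p.1 ^ n * p.2 ^ m))) + n * (ε * H' / (1 + ε * H))))) := by
  have hl : ∀ z v : ℂ, HasDerivAt (fun t : ℂ => z + t * v) v 0 := fun z v => by
    simpa using ((hasDerivAt_id (0 : ℂ)).mul_const v).const_add z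
  have hγ : p + (0 : ℂ) • (p.1 * ξ, p.2 * η) = (p.1, p.2) := by simp
  have h1 : HasDerivAt (fun t : ℂ => (p + t • (p.1 * ξ, p.2 * η)).1) (p.1 * ξ) 0 := hl _ _
  have h2 : HasDerivAt (fun t : ℂ => (p + t • (p.1 * ξ, p.2 * η)).2) (p.2 * η) 0 := hl _ _
  refine fderiv_eq_of_hasDerivAt_line (analyticAt_straightening hK hσ hs).differentiableAt ?_
  exact hasDerivAt_straightening h1 h2 hγ hσ' hs (hasDerivAt_correction h1 h2 hγ hK' ha hb)

/-- `X` annihilates `u`, so `σ` does not contribute and the correction `H = w h(u)` varies only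
through `w`, giving `X H = ε w H`. This matches the division of `w` by `1 + ε H`. -/
theorem fderiv_straightening_normalFormX (h : (a : ℂ) * m - b * n = ε) (hε : ε * ε = 1)
    {p : ℂ × ℂ} {s' d : ℂ}
    (hK : AnalyticAt ℂ K (p.1 ^ n * p.2 ^ m)) (hK' : HasDerivAt K d (p.1 ^ n * p.2 ^ m))
    (hσ : AnalyticAt ℂ σ (p.1 ^ n * p.2 ^ m)) (hσ' : HasDerivAt σ s' (p.1 ^ n * p.2 ^ m))
    (hs : 1 + ε * correction a b m n N c ε K p ∈ Complex.slitPlane)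
    (ha : n * N ≤ a) (hb : m * N ≤ b) :
    fderiv ℂ (straightening a b m n N c ε K σ) p (normalFormX a b m n p) =
      normalFormX a b m n (straightening a b m n N c ε K σ p) := by
  have hQ : 1 + ε * correction a b m n N c ε K p ≠ 0 := Complex.slitPlane_ne_zero hs
  have hv : normalFormX a b m n p =
      (p.1 * (m * (p.1 ^ a * p.2 ^ b)), p.2 * (-(n * (p.1 ^ a * p.2 ^ b)))) := by
    ext <;> simp [normalFormX] <;> ring
  rw [hv, fderiv_straightening hK hK' hσ hσ' hs ha hb, normalFormX,
    straightening_monomial_ab h hε hQ]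
  generalize straightening a b m n N c ε K σ p = q
  generalize correction a b m n N c ε K p = H at *
  generalize p.1 ^ a * p.2 ^ b = w
  have e1 : (a : ℂ) * (m * w) + b * -(n * w) = ε * w := by linear_combination w * h
  have e2 : (n : ℂ) * (m * w) + m * -(n * w) = 0 := by ring
  rw [e1, e2]
  simp only [mul_zero, zero_mul, add_zero, zero_add, Prod.smul_mk, smul_eq_mul]
  have e3 : ε * (ε * w * H) / (1 + ε * H) = w * H / (1 + ε * H) := by
    congr 1
    linear_combination w * H * hε
  rw [e3]
  ext <;> simp only <;> field_simp <;> ring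

/-- The choice of `σ` turns `g` into `l + κ z`, and that of the correction leaves only `c₀ r` of
`f`; then `g c₀ r = l c₀` makes this contribution constant. -/
theorem fderiv_straightening_normalFormY (hm : m ≠ 0) (h : (a : ℂ) * m - b * n = ε)
    (hε : ε * ε = 1) {p : ℂ × ℂ} {s' d l κ r c₀ : ℂ} {g : ℂ → ℂ} {F : ℂ × ℂ → ℂ}
    (hK : AnalyticAt ℂ K (p.1 ^ n * p.2 ^ m)) (hK' : HasDerivAt K d (p.1 ^ n * p.2 ^ m))
    (hσ : AnalyticAt ℂ σ (p.1 ^ n * p.2 ^ m)) (hσ' : HasDerivAt σ s' (p.1 ^ n * p.2 ^ m))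
    (hs : 1 + ε * correction a b m n N c ε K p ∈ Complex.slitPlane)
    (ha : n * N ≤ a) (hb : m * N ≤ b) (hκ : κ * c₀ = 0)
    (hg : g (p.1 ^ n * p.2 ^ m) * (1 + p.1 ^ n * p.2 ^ m * s') =
      l + κ * (p.1 ^ n * p.2 ^ m * Complex.exp (σ (p.1 ^ n * p.2 ^ m))))
    (hr : g (p.1 ^ n * p.2 ^ m) * c₀ * r = l * c₀)
    (hF : F p = polarMonomials a b m n N c p +
      p.1 ^ a * p.2 ^ b * (p.1 ^ n * p.2 ^ m * d + c₀ * r)) :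
    fderiv ℂ (straightening a b m n N c ε K σ) p (normalFormY a b m n g F p) =
      normalFormY a b m n (fun z => l + κ * z) (fun q => c₀ * (q.1 ^ a * q.2 ^ b))
        (straightening a b m n N c ε K σ p) := by
  have hQ : 1 + ε * correction a b m n N c ε K p ≠ 0 := Complex.slitPlane_ne_zero hs
  have hm0 : (m : ℂ) ≠ 0 := Nat.cast_ne_zero.2 hm
  have hv : normalFormY a b m n g F p =
      (p.1 * (g (p.1 ^ n * p.2 ^ m) * (-(b * m) + F p)),
        p.2 * (g (p.1 ^ n * p.2 ^ m) * (a * m - n / m * F p))) := by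
    ext <;> simp [normalFormY] <;> ring
  rw [hv, fderiv_straightening hK hK' hσ hσ' hs ha hb, normalFormY,
    straightening_monomial_ab h hε hQ, straightening_monomial_nm h hε, ← hg]
  have hP : polarMonomials a b m n N c p + p.1 ^ a * p.2 ^ b * (p.1 ^ n * p.2 ^ m * d) =
      F p - c₀ * r * (p.1 ^ a * p.2 ^ b) := by
    rw [hF]
    ring
  rw [hP]
  have hκ' : g (p.1 ^ n * p.2 ^ m) * (1 + p.1 ^ n * p.2 ^ m * s') * c₀ = l * c₀ := by
    rw [hg]
    linear_combination p.1 ^ n * p.2 ^ m * Complex.exp (σ (p.1 ^ n * p.2 ^ m)) * hκ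
  clear hg hF hP hv hK hK' hσ hσ' hs
  generalize straightening a b m n N c ε K σ p = q
  generalize correction a b m n N c ε K p = H at *
  generalize p.1 ^ a * p.2 ^ b = w at *
  generalize p.1 ^ n * p.2 ^ m = u at *
  generalize g u = G at *
  generalize F p = P at *
  -- These are the logarithmic derivatives along `Y` of `x^a y^b` and, in `e2`, of `x^n y^m`.
  have e1 : (a : ℂ) * (G * (-(b * m) + P)) + b * (G * (a * m - n / m * P)) = ε * (G * P / m) := by
    rw [← h]
    field_simp
    ring
  have e2 : (n : ℂ) * (G * (-(b * m) + P)) + m * (G * (a * m - n / m * P)) = ε * (G * m) := by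
    rw [← h]
    field_simp
    ring
  rw [e1, e2]
  have e3 : ε * (ε * (G * P / m) * H + ε / m ^ 2 * (ε * (G * m)) * (P - c₀ * r * w)) /
      (1 + ε * H) = ε * G / m * (P - c₀ * r * (w / (1 + ε * H))) := by
    field_simp
    linear_combination (G * P * H + ε * G * (P - c₀ * r * w) - G * P * H) * hε
  rw [e3]
  generalize w / (1 + ε * H) = W
  ext
  · simp only [Prod.smul_mk, smul_eq_mul]
    have e4 : (m : ℂ) * (ε * G / m * (P - c₀ * r * W)) = ε * G * (P - c₀ * r * W) := by
      field_simp
    rw [e4]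
    linear_combination -q.1 * (b * s' * G * m * u + G * (P - c₀ * r * W)) * hε
      + q.1 * W * hr - q.1 * W * hκ'
  · simp only [Prod.smul_mk, smul_eq_mul]
    linear_combination q.2 * (a * s' * G * m * u + n * G / m * (P - c₀ * r * W)) * hε
      - q.2 * n / m * W * hr + q.2 * n / m * W * hκ'

theorem isInvertible_fderiv_of_mul {E₁ E₂ : ℂ × ℂ → ℂ} (h1 : AnalyticAt ℂ E₁ 0)
    (h2 : AnalyticAt ℂ E₂ 0) (h10 : E₁ 0 = 1) (h20 : E₂ 0 = 1) :
    (fderiv ℂ (fun p : ℂ × ℂ => (p.1 * E₁ p, p.2 * E₂ p)) 0).IsInvertible := by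
  have h3 : HasFDerivAt (fun p : ℂ × ℂ => (p.1 * E₁ p, p.2 * E₂ p))
      (ContinuousLinearMap.id ℂ (ℂ × ℂ)) 0 := by
    convert! (hasFDerivAt_fst.mul h1.differentiableAt.hasFDerivAt).prodMk
      (hasFDerivAt_snd.mul h2.differentiableAt.hasFDerivAt) using 1
    ext <;> simp [h10, h20]
  rw [h3.fderiv]
  exact ⟨ContinuousLinearEquiv.refl ℂ (ℂ × ℂ), rfl⟩

/-- The commuting vector fields `normalFormX`, `normalFormY` are conjugate to polynomial ones. -/
theorem exists_straightening {a b m n : ℕ} (ha : 0 < a) (hm : 0 < m) (hn : 0 < n)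
    {ε : ℤ} (h : (a : ℤ) * m - b * n = ε) (hε : ε * ε = 1) {f g : ℂ → ℂ} {F : ℂ × ℂ → ℂ}
    {c : ℤ → ℂ} (hg : AnalyticAt ℂ g 0) (hc : IsLaurentSeriesAtZero f c)
    (hF : IsHolomorphicExtension a b m n f F)
    (hcond : g 0 ≠ 0 ∨ (g 0 = 0 ∧ iteratedDeriv 2 g 0 = 0 ∧ c 0 = 0 ∧ deriv g 0 ≠ 0)) :
    ∃ (l κ : ℂ) (θ : ℂ × ℂ → ℂ × ℂ), l * κ = 0 ∧ κ * c 0 = 0 ∧ AnalyticAt ℂ θ 0 ∧ θ 0 = 0 ∧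
      (fderiv ℂ θ 0).IsInvertible ∧ ∀ᶠ p in 𝓝 (0 : ℂ × ℂ),
        fderiv ℂ θ p (normalFormX a b m n p) = normalFormX a b m n (θ p) ∧
        fderiv ℂ θ p (normalFormY a b m n g F p) =
          normalFormY a b m n (fun z => l + κ * z) (fun q => c 0 * (q.1 ^ a * q.2 ^ b)) (θ p) := by
  obtain ⟨N, k, hNa, hNb, hk, hk0, hFk⟩ := hF.exists_polarMonomials hm hn hc
  obtain ⟨l, κ, r, σ, σ', hlκ, hκc, hr, hr0, hσ, hσ0, hσ', hgσ, hgr⟩ :=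
    exists_linearizing_exponent hg hcond
  -- Since `r 0 = 1`, subtracting `c 0 * r` removes the constant term of `k`; the quotient by `z`
  -- then has a holomorphic primitive.
  obtain ⟨k', hk', hkk'⟩ := (hk.fun_sub (analyticAt_const.fun_mul hr (f := fun _ => c 0))
    ).exists_eq_mul_of_apply_zero (by simp [hk0, hr0])
  obtain ⟨K, hK, hK0, hK'⟩ := hk'.exists_primitive
  have h' : (a : ℂ) * m - b * n = (ε : ℂ) := by exact_mod_cast h
  have hε' : (ε : ℂ) * ε = 1 := by exact_mod_cast hε
  set C : ℕ → ℂ := fun j => c (-((j : ℤ) + 1)) with hC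
  have hu0 : (0 : ℂ × ℂ).1 ^ n * (0 : ℂ × ℂ).2 ^ m = 0 := by simp [hn.ne']
  have hu : Tendsto (fun p : ℂ × ℂ => p.1 ^ n * p.2 ^ m) (𝓝 0) (𝓝 0) :=
    (by fun_prop : Continuous fun p : ℂ × ℂ => p.1 ^ n * p.2 ^ m).tendsto' _ _ hu0
  rw [← hu0] at hK hσ
  have hH0 : correction a b m n N C ε K 0 = 0 := by
    have hP : polarMonomials a b m n N (fun j => -(C j / (j + 1))) 0 = 0 := by
      refine Finset.sum_eq_zero fun j hj => ?_
      have hj' : j + 1 ≤ N := Finset.mem_range.1 hj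
      have h1 := (Nat.mul_le_mul_left n hj').trans hNa
      have h2 := (Nat.mul_le_mul_left m hj').trans hNb
      -- A constant polar monomial would make `(a, b)` a multiple of `(n, m)`, against the
      -- determinant being `±1`.
      have h3 : a - n * (j + 1) ≠ 0 ∨ b - m * (j + 1) ≠ 0 := by
        by_contra! h4
        have h5 : a = n * (j + 1) := by omega
        have h6 : b = m * (j + 1) := by omega
        have : ε = 0 := by
          rw [← h, h5, h6]
          push_cast
          ring
        simp [this] at hε
      rcases h3 with h3 | h3 <;> simp [zero_pow h3]
    simp [correction, hP, ha.ne']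
  have hs0 : 1 + ε * correction a b m n N C ε K 0 ∈ Complex.slitPlane := by simp [hH0]
  refine ⟨l, κ, straightening a b m n N C ε K σ, hlκ, hκc, analyticAt_straightening hK hσ hs0,
    by simp [straightening], ?_, ?_⟩
  · refine isInvertible_fderiv_of_mul ?_ (analyticAt_straightening_factor hK hσ hs0 _ _) ?_ ?_
    · convert! analyticAt_straightening_factor hK hσ hs0 (-b) (-m) using 3
      ring
    · simp [hH0, hn.ne', hσ0]
    · simp [hH0, hn.ne', hσ0]
  · have hs : ∀ᶠ p in 𝓝 (0 : ℂ × ℂ), 1 + ε * correction a b m n N C ε K p ∈ Complex.slitPlane :=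
      (continuousAt_const.add (continuousAt_const.mul
        (analyticAt_correction hK).continuousAt)).eventually
        (Complex.isOpen_slitPlane.mem_nhds hs0)
    rw [hu0] at hK hσ
    filter_upwards [hs, hu.eventually hK', hu.eventually hσ', hu.eventually hK.eventually_analyticAt,
      hu.eventually hσ.eventually_analyticAt, hu.eventually hgσ, hu.eventually hgr, hFk]
      with p h1 h2 h3 h4 h5 h6 h7 h8
    refine ⟨fderiv_straightening_normalFormX h' hε' h4 h2 h5 h3 h1 hNa hNb,
      fderiv_straightening_normalFormY hm.ne' h' hε' h4 h2 h5 h3 h1 hNa hNb hκc h6 h7 ?_⟩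
    rw [h8, ← hkk']
    ring

end ConjugationOfVectorFields

/-! ### Embedding the germ into the toric surface. -/

section Main

/-- An analytic map with invertible derivative at `p` restricts to an open partial homeomorphism
near `p`, whose inverse is analytic. -/
theorem exists_openPartialHomeomorph_of_isInvertible_fderiv {E : Type*} [NormedAddCommGroup E]
    [NormedSpace ℂ E] [CompleteSpace E] {Θ : E → E} {p : E} (hΘ : AnalyticAt ℂ Θ p)
    (hinv : (fderiv ℂ Θ p).IsInvertible) {P : E → Prop} (hP : ∀ᶠ q in 𝓝 p, P q) :
    ∃ e : OpenPartialHomeomorph E E, (e : E → E) = Θ ∧ p ∈ e.source ∧ (∀ q ∈ e.source, P q) ∧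
      (∀ q ∈ e.source, AnalyticAt ℂ Θ q) ∧ ∀ q ∈ e.target, AnalyticAt ℂ e.symm q := by
  obtain ⟨L, hL⟩ := hinv
  have hs : HasStrictFDerivAt Θ (L : E →L[ℂ] E) p := by
    rw [hL]
    exact hΘ.hasStrictFDerivAt
  have hev : ∀ᶠ q in 𝓝 p, P q ∧ AnalyticAt ℂ Θ q ∧
      fderiv ℂ Θ q ∈ Set.range ((↑) : (E ≃L[ℂ] E) → E →L[ℂ] E) := by
    refine hP.and (hΘ.eventually_analyticAt.and ?_)
    exact hΘ.fderiv.continuousAt.eventually_mem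
      (ContinuousLinearEquiv.isOpen.mem_nhds ⟨L, hL⟩)
  obtain ⟨t, ht, hto, hpt⟩ := eventually_nhds_iff.1 hev
  refine ⟨(hs.toOpenPartialHomeomorph Θ).restrOpen t hto, rfl,
    ⟨hs.mem_toOpenPartialHomeomorph_source, hpt⟩, fun q hq => (ht q hq.2).1,
    fun q hq => (ht q hq.2).2.1, fun q hq => ?_⟩
  have hq' := ((hs.toOpenPartialHomeomorph Θ).restrOpen t hto).map_target hq
  obtain ⟨-, h1, L', hL'⟩ := ht _ hq'.2
  exact OpenPartialHomeomorph.analyticAt_symm _ hq h1 hL'.symm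

variable {a b m n : ℕ} {ε : ℤ} (h : (a : ℤ) * m - b * n = ε) (hε : ε * ε = 1)

theorem infinitesimalGenerator_toricAction_inl_fst (α β ν : ℂ) (p : ℂ × ℂ) :
    infinitesimalGenerator (toricAction α β ν h hε) (1, 0) (Glued.inl _ p) =
      (mfderiv 𝓘(ℂ, ℂ × ℂ) 𝓘(ℂ, ℂ × ℂ) (Glued.inl (toricGluing a b m n ε h hε)) p :
        ℂ × ℂ →L[ℂ] ℂ × ℂ) (normalFormX a b m n p) := by
  have hε' : (ε : ℂ) * ε = 1 := by exact_mod_cast hε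
  rw [infinitesimalGenerator_toricAction_inl, fderiv_monomialFlow]
  congr 1
  refine Prod.ext (α := ℂ) (β := ℂ) ?_ ?_
  · simp only [normalFormX, Prod.smul_mk, smul_eq_mul]
    linear_combination p.1 * m * (p.1 ^ a * p.2 ^ b) * hε'
  · simp only [normalFormX, Prod.smul_mk, smul_eq_mul]
    linear_combination -p.2 * n * (p.1 ^ a * p.2 ^ b) * hε'

/-- In `U = 1/u`, `W = 1/w` the affine generator is `-(αU + β) ∂_U - εν ∂_W`; comparison with the
polynomial `Y` dictates the three parameters. The cross term in `u w` drops out because `κ c₀ = 0`.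
-/
theorem infinitesimalGenerator_toricAction_inl_snd (hm : m ≠ 0) {l κ c₀ : ℂ} (hκ : κ * c₀ = 0)
    (p : ℂ × ℂ) :
    infinitesimalGenerator (toricAction (m * ε * l) (m * ε * κ) (l * c₀ / m) h hε) (0, 1)
        (Glued.inl _ p) =
      (mfderiv 𝓘(ℂ, ℂ × ℂ) 𝓘(ℂ, ℂ × ℂ) (Glued.inl (toricGluing a b m n ε h hε)) p :
        ℂ × ℂ →L[ℂ] ℂ × ℂ) (normalFormY a b m n (fun z => l + κ * z)
          (fun q => c₀ * (q.1 ^ a * q.2 ^ b)) p) := by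
  have hε' : (ε : ℂ) * ε = 1 := by exact_mod_cast hε
  have hm0 : (m : ℂ) ≠ 0 := Nat.cast_ne_zero.2 hm
  have hmm : (m : ℂ) * (m : ℂ)⁻¹ = 1 := mul_inv_cancel₀ hm0
  rw [infinitesimalGenerator_toricAction_inl, fderiv_monomialFlow]
  congr 1
  simp only [normalFormY, Prod.smul_mk, smul_eq_mul]
  generalize p.1 ^ a * p.2 ^ b = w
  generalize p.1 ^ n * p.2 ^ m = u
  refine Prod.ext (α := ℂ) (β := ℂ) ?_ ?_
  · simp only
    linear_combination (p.1 * (-b * m * (l + κ * u) + m * (l * c₀ / m) * w)) * hε'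
      + p.1 * l * c₀ * w * hmm - p.1 * u * w * hκ
  · simp only
    linear_combination (p.2 * (a * m * (l + κ * u) - n * (l * c₀ / m) * w)) * hε'
      + p.2 * u * n / m * w * hκ

theorem theoremA (a b m n : ℕ) (ha : 0 < a) (hb : 0 < b) (hm : 0 < m) (hn : 0 < n)
    (hdet : (a : ℤ) * m - b * n = 1 ∨ (a : ℤ) * m - b * n = -1)
    (f g : ℂ → ℂ) (hf : MeromorphicAt f 0) (hg : AnalyticAt ℂ g 0)
    (c : ℤ → ℂ) (hc : IsLaurentSeriesAtZero f c)
    (hcond : g 0 ≠ 0 ∨ (g 0 = 0 ∧ iteratedDeriv 2 g 0 = 0 ∧ c 0 = 0 ∧ deriv g 0 ≠ 0))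
    (V : Set (ℂ × ℂ)) (hV : IsOpen V) (h0V : (0 : ℂ × ℂ) ∈ V)
    (X Y : ℂ × ℂ → ℂ × ℂ) (hX : AnalyticOnNhd ℂ X V) (hY : AnalyticOnNhd ℂ Y V)
    (hXY : HasNormalForm a b m n f g X Y) :
    ∃ (M : Type) (_ : TopologicalSpace M) (_ : ChartedSpace (ℂ × ℂ) M)
      (_ : IsManifold 𝓘(ℂ, ℂ × ℂ) ω M),
      T2Space M ∧ SecondCountableTopology M ∧ ConnectedSpace M ∧ NoncompactSpace M ∧
      ∃ (X' Y' : (p : M) → TangentSpace 𝓘(ℂ, ℂ × ℂ) p) (Φ : ℂ × ℂ → M → M)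
        (U : Set (ℂ × ℂ)) (ψ : OpenPartialHomeomorph (ℂ × ℂ) M),
        IsHolomorphicVectorField X' ∧ IsHolomorphicVectorField Y' ∧
        IsCompleteVectorField X' ∧ IsCompleteVectorField Y' ∧
        IsHolomorphicActionGeneratedBy Φ X' Y' ∧
        IsOpen U ∧ (0 : ℂ × ℂ) ∈ U ∧ U ⊆ V ∧
        IsBiholomorphismOnto ψ U ∧ PushesForwardTo ψ U X X' ∧ PushesForwardTo ψ U Y Y' := by
  obtain ⟨ε, h, hε⟩ : ∃ ε : ℤ, (a : ℤ) * m - b * n = ε ∧ ε * ε = 1 := by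
    rcases hdet with h | h
    · exact ⟨1, h, rfl⟩
    · exact ⟨-1, h, rfl⟩
  obtain ⟨φ, F, hφ, hφ0, hφinv, hF, hφXY⟩ := hXY
  obtain ⟨l, κ, θ, hlκ, hκc, hθ, hθ0, hθinv, hθXY⟩ :=
    exists_straightening ha hm hn h hε hg hc hF hcond
  rw [← hφ0] at hθ hθinv hθXY
  have hΘ : AnalyticAt ℂ (θ ∘ φ) 0 := hθ.comp hφ
  have hΘinv : (fderiv ℂ (θ ∘ φ) 0).IsInvertible := by
    rw [fderiv_comp 0 hθ.differentiableAt hφ.differentiableAt]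
    exact hθinv.comp hφinv
  have hΘXY : ∀ᶠ p in 𝓝 (0 : ℂ × ℂ), p ∈ V ∧
      fderiv ℂ (θ ∘ φ) p (X p) = normalFormX a b m n ((θ ∘ φ) p) ∧
      fderiv ℂ (θ ∘ φ) p (Y p) = normalFormY a b m n (fun z => l + κ * z)
        (fun q => c 0 * (q.1 ^ a * q.2 ^ b)) ((θ ∘ φ) p) := by
    filter_upwards [hV.mem_nhds h0V, hφXY, hφ.continuousAt.eventually hθXY,
      hφ.eventually_analyticAt, hφ.continuousAt.eventually hθ.eventually_analyticAt]
      with p h1 h2 h3 h4 h5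
    rw [fderiv_comp p h5.differentiableAt h4.differentiableAt]
    refine ⟨h1, ?_, ?_⟩
    · rw [ContinuousLinearMap.comp_apply, h2.1, h3.1, Function.comp_apply]
    · rw [ContinuousLinearMap.comp_apply, h2.2, h3.2, Function.comp_apply]
  obtain ⟨e, he, he0, heP, hea, hes⟩ :=
    exists_openPartialHomeomorph_of_isInvertible_fderiv hΘ hΘinv hΘXY
  have hαβ : (m * ε * l : ℂ) * (m * ε * κ) = 0 := by linear_combination m * ε * m * ε * hlκ
  have hact := contMDiff_toricAction (α := m * ε * l) (β := m * ε * κ) (ν := l * c 0 / m)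
    h hε ha hb hm hn
  have hzero := toricAction_zero (α := m * ε * l) (β := m * ε * κ) (ν := l * c 0 / m) h hε
  have hadd := toricAction_add (ν := l * c 0 / m) h hε ha hb hm hn hαβ
  have hψ : ∀ p ∈ e.source, ∀ v : ℂ × ℂ,
      (mfderiv 𝓘(ℂ, ℂ × ℂ) 𝓘(ℂ, ℂ × ℂ)
        (Glued.inl (toricGluing a b m n ε h hε) ∘ (θ ∘ φ)) p : ℂ × ℂ →L[ℂ] ℂ × ℂ) v =
      (mfderiv 𝓘(ℂ, ℂ × ℂ) 𝓘(ℂ, ℂ × ℂ) (Glued.inl (toricGluing a b m n ε h hε)) ((θ ∘ φ) p) :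
        ℂ × ℂ →L[ℂ] ℂ × ℂ) (fderiv ℂ (θ ∘ φ) p v) := fun p hp v => by
    have h1 := ((Glued.contMDiff_inl (e := toricGluing a b m n ε h hε)
      (k := ω)).mdifferentiable (by simp) ((θ ∘ φ) p)).hasMFDerivAt.comp p
      (hea p hp).differentiableAt.hasFDerivAt.hasMFDerivAt
    exact congrArg (fun L : ℂ × ℂ →L[ℂ] ℂ × ℂ => L v) h1.mfderiv
  refine ⟨ToricSurface h hε, inferInstance, inferInstance, inferInstance,
    toricSurface_t2Space h hε hm hn, inferInstance, inferInstance, inferInstance,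
    infinitesimalGenerator _ (1, 0), infinitesimalGenerator _ (0, 1), _, e.source,
    e.trans (Glued.inlHomeomorph _),
    isHolomorphicVectorField_infinitesimalGenerator hact hzero _,
    isHolomorphicVectorField_infinitesimalGenerator hact hzero _,
    isCompleteVectorField_infinitesimalGenerator hact hzero hadd _,
    isCompleteVectorField_infinitesimalGenerator hact hzero hadd _,
    isHolomorphicActionGeneratedBy_infinitesimalGenerator hact hzero hadd,
    e.open_source, he0, fun p hp => (heP p hp).1, ⟨?_, ?_, ?_⟩, ?_, ?_⟩
  · simp
  · intro p hp
    have hp' : p ∈ e.source := hp.1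
    rw [OpenPartialHomeomorph.coe_trans, he]
    exact ((Glued.contMDiff_inl _).comp p
      (hea p hp').contDiffAt.contMDiffAt).contMDiffWithinAt
  · have h1 : ContMDiffOn 𝓘(ℂ, ℂ × ℂ) 𝓘(ℂ, ℂ × ℂ) ω e.symm e.target := fun q hq =>
      (hes q hq).contDiffAt.contMDiffAt.contMDiffWithinAt
    rw [OpenPartialHomeomorph.coe_trans_symm]
    refine h1.comp (Glued.contMDiffOn_inlHomeomorph_symm.mono fun z hz => ?_) fun z hz => hz.2
    simpa using hz.1
  · intro p hp
    rw [OpenPartialHomeomorph.coe_trans, he]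
    refine (hψ p hp (X p)).trans ?_
    rw [(heP p hp).2.1]
    exact (infinitesimalGenerator_toricAction_inl_fst h hε _ _ _ _).symm
  · intro p hp
    rw [OpenPartialHomeomorph.coe_trans, he]
    refine (hψ p hp (Y p)).trans ?_
    rw [(heP p hp).2.2]
    exact (infinitesimalGenerator_toricAction_inl_snd h hε hm.ne' hκc _).symm

end Main
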